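/- **Timed automata and zone graph.** Let $\mathcal A=(Q,q_0,X,T,\mathrm{Acc})$ be a diagonal-free timed automaton: $Q$ and $X$ (clocks) are finite, $\mathrm{Acc}\subseteq Q$, and $T$ is a finite set of transitions $t=(q,g,R,q')$ with $g$ a finite conjunction of constraints $x\mathbin{\#}c$, $\#\in\{<,\le,=,\ge,>\}$, $c\in\mathbb N$, and $R\subseteq X$ a set of clocks to reset. For a set $Z\subseteq\mathbb R_{\ge0}^X$ let $\mathrm{Post}_t(Z)=\{[R](v+\delta): v\in Z,\ \delta\ge 0,\ v+\delta\models g\}$. The zone graph $ZG(\mathcal A)$ has initial node $(q_0,\{\mathbf 0\})$ and edges $(q,Z)\to(q',\mathrm{Post}_t(Z))$ for $t=(q,g,R,q')\in T$. An accepting state is *reachable* in $ZG(\mathcal A)$ if some node $(q,Z)$ with $q\in\mathrm{Acc}$ and $Z\neq\emptyset$ is reachable from the initial node. **Closure.** For a bound function $\alpha:X\to\mathbb N\cup\{-\infty\}$, a region is a set of valuations specified by one constraint for each clock $x$ from $\{x=c: 0\le c\le\alpha_x\}\cup\{c-1<x<c: 1\le c\le\alpha_x\}\cup\{x>\alpha_x\}$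 and by the order of the fractional parts of each pair of clocks whose constraints are of the form $c-1<x<c$. $\mathrm{Closure}_\alpha(S)$ is the union of the regions that intersect $S$. For a guard $g$, a set $R$ and a bound function $\alpha$, let $\mathrm{maxedge}(g,R,\alpha)(x)$ be the maximum of the constants that $x$ is compared with in $g$ and of $\alpha(x)$ if $x\notin R$ (and $-\infty$ if there are none). **Algorithm.** It builds a tree of nodes $(q,Z,\alpha)$ where $(q,Z)$ is a node of $ZG(\mathcal A)$ (unapproximated) and $\alpha$ is a bound function that changes over time and is initially $-\infty$ everywhere. The root is $(q_0,\{\mathbf 0\})$, and an expanded node has one child for each transition out of its state, including children with an empty zone, which are not explored. Nodes are unexplored, nontentative, or tentative with respect to another node. Initially all nodes are unexplored and the stack contains the root. As long as the stack is nonempty, the algorithm pops a node $n$, runs $\mathrm{explore}(n)$ and then $\mathrm{resolve}()$; when the stack is empty, it answers "empty". The order in which the loops below treat their items and the choice of $n'$ are arbitrary. * $\mathrm{explore}(n)$, $n=(q,Z,\alpha)$: if $q\in\mathrm{Acc}$, halt with the answer "not empty". Otherwise, if there is a nontentative $n'=(q,Z',\alpha')$ with $Z\subseteq\mathrm{Closure}_{\alpha'}(Z')$,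 then mark $n$ tentative with respect to one such $n'$, set $\alpha:=\alpha'$ and run $\mathrm{propagate}(\mathrm{parent}(n))$. If there is none, mark $n$ nontentative (so $n$ is expanded), run $\mathrm{propagate}(n)$, and then explore each child of $n$ with a nonempty zone. * $\mathrm{resolve}()$: for each $n=(q,Z,\alpha)$ that is tentative with respect to some $n'=(q,Z',\alpha')$, if $Z\not\subseteq\mathrm{Closure}_{\alpha'}(Z')$ then reopen $n$: $n$ becomes unexplored again, set $\alpha:=-\infty$, run $\mathrm{propagate}(\mathrm{parent}(n))$ and push $n$ on the stack. * $\mathrm{propagate}(n)$: set $\alpha$ to the maximum of $\mathrm{maxedge}(g,R,\alpha_s)$ over all edges with guard $g$ and reset $R$ from $n$ to a child $(q_s,Z_s,\alpha_s)$. If $\alpha$ has changed, then for each node $m=(q_m,Z_m,\alpha_m)$ that is tentative with respect to $n$ set $\alpha_m:=\alpha$ and run $\mathrm{propagate}(\mathrm{parent}(m))$; after that, if $n$ is not the root, run $\mathrm{propagate}(\mathrm{parent}(n))$. **Theorem.** Consider any (maximal) execution of the algorithm on $\mathcal A$. 1. If it reaches (calls $\mathrm{explore}$ on) a node with an accepting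 state and a nonempty zone, then an accepting state is reachable in $ZG(\mathcal A)$. 2. Suppose that the execution does not go through infinitely many resolution phases (calls of $\mathrm{resolve}$); this holds in particular if it terminates. Then an accepting state is reachable in $ZG(\mathcal A)$ if and only if the execution reaches a node with an accepting state and a nonempty zone. Moreover the execution then terminates: it answers "not empty" if an accepting state is reachable in $ZG(\mathcal A)$, and it answers "empty" if not. -/

import Mathlib

open scoped NNReal

namespace ReachTA

/-! ### Timed automata -/

/-- The comparison symbols of clock constraints. -/
inductive Cmp where
  | lt | le | eq | ge | gt

/-- The meaning of a comparison symbol. -/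
def Cmp.holds : Cmp → ℝ≥0 → ℝ≥0 → Prop
  | .lt, a, b => a < b
  | .le, a, b => a ≤ b
  | .eq, a, b => a = b
  | .ge, a, b => b ≤ a
  | .gt, a, b => b < a

/-- An atomic constraint `x # c` with `c` a natural number. -/
structure Atom (X : Type*) where
  clock : X
  cmp : Cmp
  const : ℕ

/-- A clock constraint: a finite conjunction of atomic constraints. -/
abbrev Guard (X : Type*) := List (Atom X)

/-- A clock valuation. -/
abbrev Valuation (X : Type*) := X → ℝ≥0

/-- `v` satisfies the clock constraint `g`. -/
def Valuation.Sat {X : Type*} (v : Valuation X) (g : Guard X) : Prop :=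
  ∀ a ∈ g, a.cmp.holds (v a.clock) a.const

/-- Letting the time `d` elapse. -/
def Valuation.delay {X : Type*} (v : Valuation X) (d : ℝ≥0) : Valuation X :=
  fun x => v x + d

open Classical in
/-- Resetting the clocks in `R` to `0`. -/
noncomputable def Valuation.resetTo {X : Type*} (R : Set X) (v : Valuation X) : Valuation X :=
  fun x => if x ∈ R then 0 else v x

/-- A transition `(q, g, R, q')`. -/
structure Transition (Q X : Type*) where
  src : Q
  guard : Guard X
  reset : Set X
  dst : Q

/-- A (diagonal-free) timed automaton with set of states `Q` and set of clocks `X`; both are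
assumed finite in the theorem. -/
structure TimedAutomaton (Q X : Type*) where
  start : Q
  trans : Finset (Transition Q X)
  accepting : Set Q

/-- The transition relation on valuations: let the time `d` elapse, check the guard, reset. -/
def Transition.Fires {Q X : Type*} (t : Transition Q X) (v : Valuation X) (d : ℝ≥0)
    (v' : Valuation X) : Prop :=
  (v.delay d).Sat t.guard ∧ v' = (v.delay d).resetTo t.reset

/-- The set of valuations reached from a set of valuations by a transition. -/
def Transition.post {Q X : Type*} (t : Transition Q X) (Z : Set (Valuation X)) :
    Set (Valuation X) :=
  {v' | ∃ v ∈ Z, ∃ d : ℝ≥0, t.Fires v d v'}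

/-! ### The zone graph -/

namespace TimedAutomaton

variable {Q X : Type*}

/-- The initial zone, consisting of the valuation that is `0` on every clock. -/
def initialZone (X : Type*) : Set (Valuation X) := {fun _ => 0}

/-- The edges of the zone graph. -/
def ZoneEdge (A : TimedAutomaton Q X) (a b : Q × Set (Valuation X)) : Prop :=
  ∃ t ∈ A.trans, t.src = a.1 ∧ t.dst = b.1 ∧ b.2 = t.post a.2

/-- An accepting state is reachable in the zone graph: a node `(q, Z)` with `q` accepting and
`Z` nonempty is reachable from the initial node. (Successors with an empty zone are nodes
too; they carry no configuration.) -/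
def AcceptingReachable (A : TimedAutomaton Q X) : Prop :=
  ∃ q Z, Relation.ReflTransGen A.ZoneEdge (A.start, initialZone X) (q, Z) ∧
    q ∈ A.accepting ∧ Z.Nonempty

end TimedAutomaton

/-! ### Bound functions, regions and closure -/

/-- A bound function; the value `⊥` stands for `-∞`. -/
abbrev Bound (X : Type*) := X → WithBot ℕ

/-- The value `r` satisfies the interval constraint `c - 1 < x < c`, with `c` in
`{1, …, a}`. -/
def InInterval (a : WithBot ℕ) (c : ℕ) (r : ℝ≥0) : Prop :=
  1 ≤ c ∧ (c : WithBot ℕ) ≤ a ∧ (c : ℝ) - 1 < r ∧ (r : ℝ) < c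

/-- `v` and `w` satisfy the same constraints out of those that define the regions with respect
to the bound function `α`: for every clock `x` the constraints `x = c` with `0 ≤ c ≤ α x` and
`c - 1 < x < c` with `1 ≤ c ≤ α x` (the constraint `x > α x` holds when none of these does),
and the order of the fractional parts for all pairs of clocks with interval constraints. -/
def SameRegion {X : Type*} (α : Bound X) (v w : Valuation X) : Prop :=
  (∀ x, ∀ c : ℕ, (c : WithBot ℕ) ≤ α x → (v x = c ↔ w x = c)) ∧
  (∀ x, ∀ c : ℕ, InInterval (α x) c (v x) ↔ InInterval (α x) c (w x)) ∧
  (∀ x y, (∃ c, InInterval (α x) c (v x)) → (∃ d, InInterval (α y) d (v y)) →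
    (Int.fract (v x : ℝ) < Int.fract (v y : ℝ) ↔ Int.fract (w x : ℝ) < Int.fract (w y : ℝ)) ∧
    (Int.fract (v x : ℝ) = Int.fract (v y : ℝ) ↔ Int.fract (w x : ℝ) = Int.fract (w y : ℝ)))

/-- The regions with respect to `α`. -/
def IsRegion {X : Type*} (α : Bound X) (R : Set (Valuation X)) : Prop :=
  ∃ v, R = {w | SameRegion α v w}

/-- The closure abstraction: the union of the regions that intersect `S`. -/
def closureAbs {X : Type*} (α : Bound X) (S : Set (Valuation X)) : Set (Valuation X) :=
  ⋃₀ {R | IsRegion α R ∧ (R ∩ S).Nonempty}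

open Classical in
/-- The maximal constant that `x` is compared with in `g`, and `-∞` if there is none. -/
noncomputable def guardBound {X : Type*} (g : Guard X) : Bound X :=
  fun x => g.foldr (fun a b => (if a.clock = x then (a.const : WithBot ℕ) else ⊥) ⊔ b) ⊥

open Classical in
/-- The bound function that a successor with bound function `α` requires at the source of an
edge with guard `g` and reset `R`. -/
noncomputable def maxedge {X : Type*} (g : Guard X) (R : Set X) (α : Bound X) : Bound X :=
  fun x => (if x ∈ R then ⊥ else α x) ⊔ guardBound g x

/-! ### The algorithm -/

/-- A node of the reachability tree, given by the sequence of transitions that leads to it from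
the root, the last one first. The parent of a node `n`
other than the root `[]` is `n.tail`. -/
abbrev Node (Q X : Type*) := List (Transition Q X)

/-- The mark of a node: not explored (not yet, or to be explored anew), nontentative,
or tentative with respect to another node. -/
inductive Mark (Q X : Type*) where
  | unexplored
  | nontentative
  | tentative (cover : Node Q X)

/-- The global variables: the marks and the bound functions of the nodes, and the stack of the
nodes that the main loop has to explore. -/
structure Store (Q X : Type*) where
  mark : Node Q X → Mark Q X
  bound : Node Q X → Bound X
  stack : List (Node Q X)

/-- The points of the program at which a function is called or a loop continues. A `for each`
loop carries the set of the items that are still to be treated. -/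
inductive Frame (Q X : Type*) where
  /-- the test of the `while` loop of the main program -/
  | main
  /-- the call `explore(n)` -/
  | explore (n : Node Q X)
  /-- the loop of `explore` over children -/
  | exploreLoop (S : Set (Node Q X))
  /-- the call `resolve()` -/
  | resolve
  /-- the loop of `resolve` over tentative nodes -/
  | resolveLoop (S : Set (Node Q X))
  /-- the command `push(n, stack)` -/
  | push (n : Node Q X)
  /-- the call `propagate(n)` -/
  | propagate (n : Node Q X)
  /-- the loop of `propagate(n)` over the nodes that are tentative with respect to `n` -/
  | propagateLoop (n : Node Q X) (S : Set (Node Q X))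

/-- A configuration of the algorithm: it is running, with a store and a call stack, or it has
halted with the answer "not empty" or "empty". -/
inductive Config (Q X : Type*) where
  | run (σ : Store Q X) (calls : List (Frame Q X))
  | notEmpty
  | empty

open Classical in
/-- Changing the mark of a node. -/
noncomputable def Store.setMark {Q X : Type*} (σ : Store Q X) (n : Node Q X) (m : Mark Q X) :
    Store Q X :=
  { σ with mark := Function.update σ.mark n m }

open Classical in
/-- Changing the bound function of a node. -/
noncomputable def Store.setBound {Q X : Type*} (σ : Store Q X) (n : Node Q X) (α : Bound X) :
    Store Q X :=
  { σ with bound := Function.update σ.bound n α }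

/-- Changing the stack. -/
def Store.setStack {Q X : Type*} (σ : Store Q X) (s : List (Node Q X)) : Store Q X :=
  { σ with stack := s }

namespace TimedAutomaton

variable {Q X : Type*}

/-- The state of a node. -/
def nodeState (A : TimedAutomaton Q X) : Node Q X → Q
  | [] => A.start
  | t :: _ => t.dst

/-- The (unapproximated) zone of a node. -/
def nodeZone (A : TimedAutomaton Q X) : Node Q X → Set (Valuation X)
  | [] => initialZone X
  | t :: n => t.post (A.nodeZone n)

/-- The children of a node, one for each transition out of its state, including those with an
empty zone. -/
def children (A : TimedAutomaton Q X) (n : Node Q X) : Set (Node Q X) :=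
  {m | ∃ t ∈ A.trans, t.src = A.nodeState n ∧ m = t :: n}

open Classical in
/-- The maximum, over the children of `n`, of the bound functions that they require at `n`. -/
noncomputable def childrenBound (A : TimedAutomaton Q X) (σ : Store Q X) (n : Node Q X) :
    Bound X :=
  (A.trans.filter (fun t => t.src = A.nodeState n)).sup
    (fun t => maxedge t.guard t.reset (σ.bound (t :: n)))

/-- The zone of `n` is included in the closure of the zone of `m`, with respect to the current
bound function of `m`. -/
def Subsumed (A : TimedAutomaton Q X) (σ : Store Q X) (n m : Node Q X) : Prop :=
  A.nodeZone n ⊆ closureAbs (σ.bound m) (A.nodeZone m)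

/-- `m` is a nontentative node that allows `n` to be marked tentative. -/
def Covers (A : TimedAutomaton Q X) (σ : Store Q X) (m n : Node Q X) : Prop :=
  σ.mark m = .nontentative ∧ A.nodeState m = A.nodeState n ∧ A.Subsumed σ n m

/-- One step of the algorithm. The choice of a covering node and the order in which a
`for each` loop treats its items are nondeterministic. -/
inductive Step (A : TimedAutomaton Q X) : Config Q X → Config Q X → Prop
  -- main
  | mainPop (σ n s k) (h : σ.stack = n :: s) :
      Step A (.run σ (.main :: k)) (.run (σ.setStack s) (.explore n :: .resolve :: .main :: k))
  | mainEnd (σ k) (h : σ.stack = []) :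
      Step A (.run σ (.main :: k)) .empty
  -- explore
  | exploreAccept (σ n k) (h : A.nodeState n ∈ A.accepting) :
      Step A (.run σ (.explore n :: k)) .notEmpty
  | exploreTentative (σ n m k) (h : A.nodeState n ∉ A.accepting) (hm : A.Covers σ m n) :
      Step A (.run σ (.explore n :: k))
        (.run ((σ.setMark n (.tentative m)).setBound n (σ.bound m)) (.propagate n.tail :: k))
  | exploreExpand (σ n k) (h : A.nodeState n ∉ A.accepting) (hm : ∀ m, ¬ A.Covers σ m n) :
      Step A (.run σ (.explore n :: k))
        (.run (σ.setMark n .nontentative) (.propagate n :: .exploreLoop (A.children n) :: k))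
  | exploreLoopChild (σ) (S : Set (Node Q X)) (m k) (hm : m ∈ S) (hZ : (A.nodeZone m).Nonempty) :
      Step A (.run σ (.exploreLoop S :: k)) (.run σ (.explore m :: .exploreLoop (S \ {m}) :: k))
  | exploreLoopSkip (σ) (S : Set (Node Q X)) (m k) (hm : m ∈ S) (hZ : A.nodeZone m = ∅) :
      Step A (.run σ (.exploreLoop S :: k)) (.run σ (.exploreLoop (S \ {m}) :: k))
  | exploreLoopEnd (σ k) :
      Step A (.run σ (.exploreLoop ∅ :: k)) (.run σ k)
  -- resolve
  | resolveStart (σ k) :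
      Step A (.run σ (.resolve :: k))
        (.run σ (.resolveLoop {n | ∃ m, σ.mark n = .tentative m} :: k))
  | resolveLoopKeep (σ) (S : Set (Node Q X)) (n m k) (hn : n ∈ S)
      (hm : σ.mark n = .tentative m) (h : A.Subsumed σ n m) :
      Step A (.run σ (.resolveLoop S :: k)) (.run σ (.resolveLoop (S \ {n}) :: k))
  | resolveLoopReopen (σ) (S : Set (Node Q X)) (n m k) (hn : n ∈ S)
      (hm : σ.mark n = .tentative m) (h : ¬ A.Subsumed σ n m) :
      Step A (.run σ (.resolveLoop S :: k))
        (.run ((σ.setMark n .unexplored).setBound n ⊥)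
          (.propagate n.tail :: .push n :: .resolveLoop (S \ {n}) :: k))
  | resolveLoopEnd (σ k) :
      Step A (.run σ (.resolveLoop ∅ :: k)) (.run σ k)
  | pushNode (σ n k) :
      Step A (.run σ (.push n :: k)) (.run (σ.setStack (n :: σ.stack)) k)
  -- propagate
  | propagateSame (σ n k) (h : A.childrenBound σ n = σ.bound n) :
      Step A (.run σ (.propagate n :: k)) (.run σ k)
  | propagateChange (σ n k) (h : A.childrenBound σ n ≠ σ.bound n) :
      Step A (.run σ (.propagate n :: k))
        (.run (σ.setBound n (A.childrenBound σ n))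
          (.propagateLoop n {m | σ.mark m = .tentative n} :: k))
  | propagateLoopNext (σ n) (S : Set (Node Q X)) (m k) (hm : m ∈ S) :
      Step A (.run σ (.propagateLoop n S :: k))
        (.run (σ.setBound m (σ.bound n)) (.propagate m.tail :: .propagateLoop n (S \ {m}) :: k))
  | propagateLoopUp (σ n k) (h : n ≠ []) :
      Step A (.run σ (.propagateLoop n ∅ :: k)) (.run σ (.propagate n.tail :: k))
  | propagateLoopRoot (σ k) :
      Step A (.run σ (.propagateLoop [] ∅ :: k)) (.run σ k)

/-- The initial configuration: all bound functions are `-∞`, the stack contains the root. -/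
def initialConfig (Q X : Type*) : Config Q X :=
  .run { mark := fun _ => .unexplored, bound := fun _ => ⊥, stack := [[]] } [.main]

/-- A (maximal) execution of the algorithm on `A`: a sequence of steps from the initial
configuration which repeats its last configuration forever if no further step is possible. -/
def IsExecution (A : TimedAutomaton Q X) (ρ : ℕ → Config Q X) : Prop :=
  ρ 0 = initialConfig Q X ∧
  ∀ i, A.Step (ρ i) (ρ (i + 1)) ∨ ((∀ c, ¬ A.Step (ρ i) c) ∧ ρ (i + 1) = ρ i)

/-- The execution reaches a node (calls `explore` on it) with an accepting state and a nonempty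
zone. -/
def ReachesAcceptingNode (A : TimedAutomaton Q X) (ρ : ℕ → Config Q X) : Prop :=
  ∃ i σ n k, ρ i = .run σ (.explore n :: k) ∧
    A.nodeState n ∈ A.accepting ∧ (A.nodeZone n).Nonempty

end TimedAutomaton

/-- The execution enters only finitely many resolution phases. -/
def FinitelyManyResolutions {Q X : Type*} (ρ : ℕ → Config Q X) : Prop :=
  {i | ∃ σ k, ρ i = .run σ (.resolve :: k)}.Finite

end ReachTA

/-! Both answers are justified by invariants of the configurations. Halting follows from a measure
that decreases in every step that neither halts nor enters `resolve`.

The answer "not empty" is sound because every node on which `explore` is called is the root or a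
child of a nontentative node, and the transitions that lead to it form a path of the zone graph with
the same zones.

For the answer "empty", consider the moment when the stack is empty. Every tree node with a nonempty
zone is nontentative or tentative, each tentative node is subsumed by its cover and has its bound,
and the bound of a nontentative node dominates `maxedge` along its edges. Under that domination
region equivalence is a simulation (`SameRegion.exists_fires`), because delays can be matched
(`RegionEquiv.exists_delay`). By induction along a path of the zone graph, every valuation reached
is therefore equivalent to one in the zone of a nontentative node with the same state
(`exists_sameRegion_of_reachable`), and nontentative nodes are not accepting.

Propagation is not atomic, so `PropInv` allows bounds to be out of date as long as a pending call or
loop will repair them. It also records a direction: bounds only increase while nodes are explored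
and only decrease while tentative nodes are resolved. Decreasing bounds enlarge closures, so the
subsumptions that `resolve` has already checked stay valid until it ends.

All bounds stay below a constant `N`, so zones matter only up to the finitely many signatures for
`N`. Two nontentative nodes never have the same state and the same set of signatures, which bounds
their number and makes the tree finite. Between two calls of `resolve` the lexicographic
`roundMeasure` decreases: the phase, the nontentative nodes still to come, the changes of bounds
still possible in the current direction, and the remaining loop work. -/

namespace ReachTA

/-! ### Regions in terms of differences -/

section Regions

variable {X : Type*}

/-- The value of the clock `x` is at most its bound. -/
def BelowBound (α : Bound X) (v : Valuation X) (x : X) : Prop :=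
  ∃ c : ℕ, (c : WithBot ℕ) ≤ α x ∧ (v x : ℝ) ≤ c

/-- Region equivalence in terms of the positions of the clock values and of their differences
relative to the integers. -/
structure RegionEquiv (α : Bound X) (v w : Valuation X) : Prop where
  lt_iff : ∀ x (c : ℕ), (c : WithBot ℕ) ≤ α x → ((v x : ℝ) < c ↔ (w x : ℝ) < c)
  le_iff : ∀ x (c : ℕ), (c : WithBot ℕ) ≤ α x → ((v x : ℝ) ≤ c ↔ (w x : ℝ) ≤ c)
  sub_lt_iff : ∀ x y, BelowBound α v x → BelowBound α v y → ∀ k : ℤ,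
    ((v x : ℝ) - v y < k ↔ (w x : ℝ) - w y < k)

theorem natCast_le_of_le {a : WithBot ℕ} {c d : ℕ} (h : c ≤ d) (hd : (d : WithBot ℕ) ≤ a) :
    (c : WithBot ℕ) ≤ a :=
  le_trans (by exact_mod_cast h) hd

theorem SameRegion.refl (α : Bound X) (v : Valuation X) : SameRegion α v v :=
  ⟨fun _ _ _ => Iff.rfl, fun _ _ => Iff.rfl, fun _ _ _ _ => ⟨Iff.rfl, Iff.rfl⟩⟩

theorem SameRegion.symm {α : Bound X} {v w : Valuation X} (h : SameRegion α v w) :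
    SameRegion α w v := by
  refine ⟨fun x c hc => (h.1 x c hc).symm, fun x c => (h.2.1 x c).symm, ?_⟩
  rintro x y ⟨c, hc⟩ ⟨d, hd⟩
  have := h.2.2 x y ⟨c, (h.2.1 x c).2 hc⟩ ⟨d, (h.2.1 y d).2 hd⟩
  exact ⟨this.1.symm, this.2.symm⟩

theorem SameRegion.trans {α : Bound X} {u v w : Valuation X} (h : SameRegion α u v)
    (h' : SameRegion α v w) : SameRegion α u w := by
  refine ⟨fun x c hc => (h.1 x c hc).trans (h'.1 x c hc),
    fun x c => (h.2.1 x c).trans (h'.2.1 x c), ?_⟩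
  rintro x y ⟨c, hc⟩ ⟨d, hd⟩
  have h1 := h.2.2 x y ⟨c, hc⟩ ⟨d, hd⟩
  have h2 := h'.2.2 x y ⟨c, (h.2.1 x c).1 hc⟩ ⟨d, (h.2.1 y d).1 hd⟩
  exact ⟨h1.1.trans h2.1, h1.2.trans h2.2⟩

theorem SameRegion.mono {α β : Bound X} (hαβ : α ≤ β) {v w : Valuation X}
    (h : SameRegion β v w) : SameRegion α v w := by
  have lift {x : X} {c : ℕ} {r : ℝ≥0} (hr : InInterval (α x) c r) : InInterval (β x) c r :=
    ⟨hr.1, hr.2.1.trans (hαβ x), hr.2.2⟩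
  refine ⟨fun x c hc => h.1 x c (hc.trans (hαβ x)), fun x c => ⟨fun hr => ?_, fun hr => ?_⟩, ?_⟩
  · exact ⟨hr.1, hr.2.1, ((h.2.1 x c).1 (lift hr)).2.2⟩
  · exact ⟨hr.1, hr.2.1, ((h.2.1 x c).2 (lift hr)).2.2⟩
  · rintro x y ⟨c, hc⟩ ⟨d, hd⟩
    exact h.2.2 x y ⟨c, lift hc⟩ ⟨d, lift hd⟩

theorem mem_closureAbs {α : Bound X} {S : Set (Valuation X)} {v : Valuation X} :
    v ∈ closureAbs α S ↔ ∃ w ∈ S, SameRegion α v w := by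
  constructor
  · rintro ⟨_, ⟨⟨u, rfl⟩, w, hw, hwS⟩, hv⟩
    exact ⟨w, hwS, SameRegion.trans (SameRegion.symm hv) hw⟩
  · rintro ⟨w, hw, h⟩
    exact ⟨_, ⟨⟨v, rfl⟩, w, h, hw⟩, SameRegion.refl α v⟩

/-- Smaller bounds impose fewer constraints, so regions become coarser. This is what makes
subsumption survive decreasing propagation. -/
theorem closureAbs_anti {α β : Bound X} (hαβ : α ≤ β) (S : Set (Valuation X)) :
    closureAbs β S ⊆ closureAbs α S := fun v hv => by
  obtain ⟨w, hw, h⟩ := mem_closureAbs.1 hv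
  exact mem_closureAbs.2 ⟨w, hw, h.mono hαβ⟩

/-- Two fractional parts differ by less than `1`, so the difference of the floors decides the
comparison unless it equals `k`. -/
theorem sub_lt_intCast_iff (a b : ℝ) (k : ℤ) :
    a - b < k ↔ ⌊a⌋ - ⌊b⌋ < k ∨ ⌊a⌋ - ⌊b⌋ = k ∧ Int.fract a < Int.fract b := by
  have ha := Int.floor_add_fract a
  have hb := Int.floor_add_fract b
  have ha0 := Int.fract_nonneg a
  have hb0 := Int.fract_nonneg b
  have ha1 := Int.fract_lt_one a
  have hb1 := Int.fract_lt_one b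
  constructor
  · intro h
    by_cases hk : ⌊a⌋ - ⌊b⌋ < k
    · exact .inl hk
    · right
      have : ⌊a⌋ - ⌊b⌋ < k + 1 := by
        have : ((⌊a⌋ - ⌊b⌋ : ℤ) : ℝ) < ((k + 1 : ℤ) : ℝ) := by push_cast; linarith
        exact_mod_cast this
      have hk' : ⌊a⌋ - ⌊b⌋ = k := by omega
      refine ⟨hk', ?_⟩
      have : (⌊a⌋ : ℝ) - ⌊b⌋ = k := by exact_mod_cast hk'
      linarith
  · rintro (h | ⟨h, h'⟩)
    · have : ((⌊a⌋ - ⌊b⌋ + 1 : ℤ) : ℝ) ≤ k := by exact_mod_cast h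
      push_cast at this
      linarith
    · have : (⌊a⌋ : ℝ) - ⌊b⌋ = k := by exact_mod_cast h
      linarith

theorem inInterval_floor {a : WithBot ℕ} {r : ℝ≥0} {c : ℕ} (hc : (c : WithBot ℕ) ≤ a)
    (hr : (r : ℝ) < c) (h0 : (r : ℝ) ≠ ⌊(r : ℝ)⌋₊) : InInterval a (⌊(r : ℝ)⌋₊ + 1) r := by
  have h1 : (⌊(r : ℝ)⌋₊ : ℝ) ≤ r := Nat.floor_le r.2
  have h2 : ⌊(r : ℝ)⌋₊ < c := (Nat.floor_lt r.2).2 hr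
  refine ⟨by omega, natCast_le_of_le h2 hc, ?_, ?_⟩
  · push_cast
    simpa using lt_of_le_of_ne h1 (Ne.symm h0)
  · push_cast
    exact Nat.lt_floor_add_one _

theorem floor_eq_of_inInterval {a : WithBot ℕ} {r : ℝ≥0} {c : ℕ} (h : InInterval a c r) :
    ⌊(r : ℝ)⌋ = (c : ℤ) - 1 := by
  rw [Int.floor_eq_iff]
  push_cast
  exact ⟨h.2.2.1.le, by linarith [h.2.2.2]⟩

theorem fract_pos_of_inInterval {a : WithBot ℕ} {r : ℝ≥0} {c : ℕ} (h : InInterval a c r) :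
    0 < Int.fract (r : ℝ) := by
  have := floor_eq_of_inInterval h
  rw [Int.fract, this]
  push_cast
  linarith [h.2.2.1]

theorem BelowBound.eq_or_inInterval {α : Bound X} {v : Valuation X} {x : X}
    (h : BelowBound α v x) :
    (∃ c : ℕ, (c : WithBot ℕ) ≤ α x ∧ v x = c) ∨ ∃ c, InInterval (α x) c (v x) := by
  obtain ⟨c, hc, hv⟩ := h
  by_cases h0 : (v x : ℝ) = ⌊(v x : ℝ)⌋₊
  · refine .inl ⟨⌊(v x : ℝ)⌋₊, natCast_le_of_le (Nat.floor_le_of_le hv) hc, ?_⟩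
    exact_mod_cast h0
  · refine .inr ⟨_, inInterval_floor hc (lt_of_le_of_ne hv ?_) h0⟩
    rintro h1
    apply h0
    rw [h1, Nat.floor_natCast]

theorem BelowBound.of_inInterval {α : Bound X} {v : Valuation X} {x : X} {c : ℕ}
    (h : InInterval (α x) c (v x)) : BelowBound α v x :=
  ⟨c, h.2.1, h.2.2.2.le⟩

theorem SameRegion.lt_of_lt {α : Bound X} {v w : Valuation X} (h : SameRegion α v w) {x : X}
    {c : ℕ} (hc : (c : WithBot ℕ) ≤ α x) (hv : (v x : ℝ) < c) : (w x : ℝ) < c := by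
  have h2 : ⌊(v x : ℝ)⌋₊ < c := (Nat.floor_lt (v x).2).2 hv
  by_cases h0 : (v x : ℝ) = ⌊(v x : ℝ)⌋₊
  · have h3 := (h.1 x _ (natCast_le_of_le h2.le hc)).1 (by exact_mod_cast h0)
    rw [h3]
    exact_mod_cast h2
  · have h3 := ((h.2.1 x _).1 (inInterval_floor hc hv h0)).2.2.2
    refine h3.trans_le ?_
    exact_mod_cast h2

theorem SameRegion.floor_eq {α : Bound X} {v w : Valuation X} (h : SameRegion α v w) {x : X}
    (hx : BelowBound α v x) : ⌊(v x : ℝ)⌋ = ⌊(w x : ℝ)⌋ := by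
  rcases hx.eq_or_inInterval with ⟨c, hc, hv⟩ | ⟨c, hc⟩
  · rw [(h.1 x c hc).1 hv, hv]
  · rw [floor_eq_of_inInterval hc, floor_eq_of_inInterval ((h.2.1 x c).1 hc)]

/-- Regions order fractional parts only for clocks in open intervals. The other clocks below their
bounds have integer values, so their fractional part `0` lies below those of all interval clocks. -/
theorem SameRegion.fract_lt_iff {α : Bound X} {v w : Valuation X} (h : SameRegion α v w)
    {x y : X} (hx : BelowBound α v x) (hy : BelowBound α v y) :
    Int.fract (v x : ℝ) < Int.fract (v y : ℝ) ↔ Int.fract (w x : ℝ) < Int.fract (w y : ℝ) := by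
  have zero {z : X} {c : ℕ} {u : Valuation X} (hz : u z = c) : Int.fract (u z : ℝ) = 0 := by
    rw [hz]; simp
  rcases hy.eq_or_inInterval with ⟨d, hd, hvy⟩ | ⟨d, hd⟩
  · rw [zero hvy, zero ((h.1 y d hd).1 hvy)]
    exact iff_of_false (Int.fract_nonneg _).not_gt (Int.fract_nonneg _).not_gt
  rcases hx.eq_or_inInterval with ⟨c, hc, hvx⟩ | ⟨c, hc⟩
  · rw [zero hvx, zero ((h.1 x c hc).1 hvx)]
    exact iff_of_true (fract_pos_of_inInterval hd)
      (fract_pos_of_inInterval ((h.2.1 y d).1 hd))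
  · exact (h.2.2 x y ⟨c, hc⟩ ⟨d, hd⟩).1

theorem SameRegion.regionEquiv {α : Bound X} {v w : Valuation X} (h : SameRegion α v w) :
    RegionEquiv α v w where
  lt_iff x c hc := ⟨h.lt_of_lt hc, h.symm.lt_of_lt hc⟩
  le_iff x c hc := by
    have h1 : (v x : ℝ) < c ↔ (w x : ℝ) < c := ⟨h.lt_of_lt hc, h.symm.lt_of_lt hc⟩
    have h2 : (v x : ℝ) = c ↔ (w x : ℝ) = c := by exact_mod_cast h.1 x c hc
    rw [le_iff_lt_or_eq, le_iff_lt_or_eq, h1, h2]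
  sub_lt_iff x y hx hy k := by
    rw [sub_lt_intCast_iff, sub_lt_intCast_iff, h.floor_eq hx, h.floor_eq hy,
      h.fract_lt_iff hx hy]

theorem RegionEquiv.belowBound_iff {α : Bound X} {v w : Valuation X} (h : RegionEquiv α v w)
    (x : X) : BelowBound α v x ↔ BelowBound α w x :=
  exists_congr fun c => and_congr_right fun hc => h.le_iff x c hc

theorem RegionEquiv.inInterval_iff {α : Bound X} {v w : Valuation X} (h : RegionEquiv α v w)
    (x : X) (c : ℕ) : InInterval (α x) c (v x) ↔ InInterval (α x) c (w x) := by
  unfold InInterval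
  refine and_congr_right fun h1 => and_congr_right fun hc => and_congr ?_ (h.lt_iff x c hc)
  have := h.le_iff x (c - 1) (natCast_le_of_le (Nat.sub_le c 1) hc)
  rw [← not_le, ← not_le, ← Nat.cast_pred h1, this]

theorem RegionEquiv.sameRegion {α : Bound X} {v w : Valuation X} (h : RegionEquiv α v w) :
    SameRegion α v w := by
  have lt_iff {x y : X} {c d : ℕ} (hx : InInterval (α x) c (v x))
      (hy : InInterval (α y) d (v y)) :
      Int.fract (v x : ℝ) < Int.fract (v y : ℝ) ↔
        Int.fract (w x : ℝ) < Int.fract (w y : ℝ) := by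
    -- The floors are `c - 1` and `d - 1`. For `k = c - d` the floors tie, and the comparison of
    -- differences is exactly the comparison of fractional parts.
    have key := h.sub_lt_iff x y (.of_inInterval hx) (.of_inInterval hy) ((c : ℤ) - d)
    have e (u : Valuation X) (hx : InInterval (α x) c (u x)) (hy : InInterval (α y) d (u y)) :
        (u x : ℝ) - u y < ((c : ℤ) - d : ℤ) ↔ Int.fract (u x : ℝ) < Int.fract (u y : ℝ) := by
      rw [sub_lt_intCast_iff, floor_eq_of_inInterval hx, floor_eq_of_inInterval hy]
      constructor
      · rintro (h | h)
        · omega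
        · exact h.2
      · exact fun h => .inr ⟨by omega, h⟩
    rwa [e v hx hy, e w ((h.inInterval_iff x c).1 hx) ((h.inInterval_iff y d).1 hy)] at key
  refine ⟨fun x c hc => ?_, h.inInterval_iff, ?_⟩
  · have h1 := h.lt_iff x c hc
    have h2 := h.le_iff x c hc
    have e (r : ℝ≥0) : r = c ↔ (r : ℝ) ≤ c ∧ ¬ (r : ℝ) < c := by
      rw [not_lt, ← le_antisymm_iff]
      norm_cast
    rw [e, e, h1, h2]
  · rintro x y ⟨c, hc⟩ ⟨d, hd⟩
    have h1 := lt_iff hc hd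
    have h2 := lt_iff hd hc
    refine ⟨h1, ?_⟩
    simp only [le_antisymm_iff, ← not_lt, h1, h2]

/-! ### Time elapse, guards and resets -/

theorem cmp_eq_cmp_of_lt_iff {α β : Type*} [LinearOrder α] [LinearOrder β] {a b : α} {c d : β}
    (h1 : a < b ↔ c < d) (h2 : b < a ↔ d < c) : cmp a b = cmp c d := by
  unfold cmp cmpUsing
  simp only [h1, h2]

/-- What matters about a delay is its position among the instants at which some clock reaches a
relevant constant. Equivalence says that these instants are ordered alike for `v` and for `w`, so a
delay in the corresponding gap, or at the corresponding instant, exists in the dense order of the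
reals. -/
theorem RegionEquiv.exists_delay [Finite X] {α : Bound X} {v w : Valuation X}
    (h : RegionEquiv α v w) (d : ℝ≥0) :
    ∃ d' : ℝ≥0, RegionEquiv α (v.delay d) (w.delay d') := by
  classical
  -- Pairs of corresponding instants: clock `x` reaches `c` after `c - v x` from `v` and after `c -
  -- w x` from `w`. The pair `(0, 0)` forces the matching delay to be nonnegative.
  let P : Set (ℝ × ℝ) := insert (0, 0)
    {p | ∃ x, ∃ c : ℕ, (c : WithBot ℕ) ≤ α x ∧ BelowBound α v x ∧
      p = ((c : ℝ) - v x, (c : ℝ) - w x)}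
  have hfin : P.Finite := by
    refine Set.Finite.insert _ ?_
    have hI : (⋃ x, (fun c : ℕ => ((c : ℝ) - v x, (c : ℝ) - w x)) ''
        {c : ℕ | (c : WithBot ℕ) ≤ α x}).Finite := by
      refine Set.finite_iUnion fun x => Set.Finite.image _ ?_
      cases hx : α x using WithBot.recBotCoe with
      | bot => simp
      | coe a =>
        refine (Set.finite_Iic a).subset fun c hc => ?_
        simpa using (show (c : WithBot ℕ) ≤ (a : WithBot ℕ) from hc)
    refine hI.subset ?_
    rintro _ ⟨x, c, hc, -, rfl⟩
    exact Set.mem_iUnion.2 ⟨x, c, hc, rfl⟩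
  have hlt : ∀ p ∈ P, ∀ q ∈ P, p.1 < q.1 ↔ p.2 < q.2 := by
    rintro _ (rfl | ⟨x, c, hc, hx, rfl⟩) _ (rfl | ⟨y, e, he, hy, rfl⟩)
    · simp
    · simpa using h.lt_iff y e he
    · simpa using not_congr (h.le_iff x c hc)
    · have := h.sub_lt_iff y x hy hx (e - c)
      push_cast at this
      constructor <;> intro h'
      · linarith [this.1 (by linarith)]
      · linarith [this.2 (by linarith)]
  let f : Order.PartialIso ℝ ℝ := ⟨hfin.toFinset, fun p hp q hq => by
    rw [Set.Finite.mem_toFinset] at hp hq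
    exact cmp_eq_cmp_of_lt_iff (hlt p hp q hq) (hlt q hq p hp)⟩
  -- The extension step of Cantor's back-and-forth argument.
  obtain ⟨b, hb⟩ := Order.PartialIso.exists_across f (d : ℝ)
  have hb' : ∀ p ∈ P, ((d : ℝ) < p.1 ↔ b < p.2) ∧ ((d : ℝ) ≤ p.1 ↔ b ≤ p.2) := by
    intro p hp
    have := hb p (hfin.mem_toFinset.2 hp)
    have h1 := lt_iff_lt_of_cmp_eq_cmp this
    have h2 := le_iff_le_of_cmp_eq_cmp this
    have h3 := lt_iff_lt_of_cmp_eq_cmp (cmp_eq_cmp_symm.1 this)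
    have h4 := le_iff_le_of_cmp_eq_cmp (cmp_eq_cmp_symm.1 this)
    exact ⟨h3, h4⟩
  have hb0 : 0 ≤ b := by
    have := (hb' (0, 0) (Set.mem_insert _ _)).1
    have hd : ¬ (d : ℝ) < 0 := not_lt.2 d.2
    exact not_lt.1 fun hlt => hd (this.2 hlt)
  lift b to ℝ≥0 using hb0
  have hpt {x : X} {c : ℕ} (hc : (c : WithBot ℕ) ≤ α x) (hx : BelowBound α v x) :
      ((v x : ℝ) + d < c ↔ (w x : ℝ) + b < c) ∧ ((v x : ℝ) + d ≤ c ↔ (w x : ℝ) + b ≤ c) := by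
    have := hb' _ (Set.mem_insert_of_mem _ ⟨x, c, hc, hx, rfl⟩)
    simpa only [lt_sub_iff_add_lt', le_sub_iff_add_le'] using this
  have hd0 : 0 ≤ (d : ℝ) := d.2
  have hb0 : 0 ≤ (b : ℝ) := b.2
  refine ⟨b, ?_, ?_, ?_⟩
  · intro x c hc
    simp only [Valuation.delay, NNReal.coe_add]
    by_cases hx : BelowBound α v x
    · exact (hpt hc hx).1
    · have hw := mt (h.belowBound_iff x).2 hx
      exact iff_of_false (fun hh => hx ⟨c, hc, by linarith⟩) (fun hh => hw ⟨c, hc, by linarith⟩)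
  · intro x c hc
    simp only [Valuation.delay, NNReal.coe_add]
    by_cases hx : BelowBound α v x
    · exact (hpt hc hx).2
    · have hw := mt (h.belowBound_iff x).2 hx
      exact iff_of_false (fun hh => hx ⟨c, hc, by linarith⟩) (fun hh => hw ⟨c, hc, by linarith⟩)
  · rintro x y ⟨c, hc, hxc⟩ ⟨e, he, hye⟩ k
    simp only [Valuation.delay, NNReal.coe_add] at hxc hye ⊢
    -- A delay preserves differences, and a clock below its bound after the delay was below it
    -- before.
    have := h.sub_lt_iff x y ⟨c, hc, by linarith⟩ ⟨e, he, by linarith⟩ k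
    rwa [add_sub_add_right_eq_sub, add_sub_add_right_eq_sub]

theorem le_guardBound {g : Guard X} {a : Atom X} (ha : a ∈ g) :
    (a.const : WithBot ℕ) ≤ guardBound g a.clock := by
  unfold guardBound
  induction g with
  | nil => cases ha
  | cons b g ih =>
    rw [List.foldr_cons]
    rcases List.mem_cons.1 ha with rfl | ha
    · simp
    · exact le_sup_of_le_right (ih ha)

theorem guardBound_le_sum (g : Guard X) (x : X) :
    guardBound g x ≤ ((g.map Atom.const).sum : ℕ) := by
  unfold guardBound
  induction g with
  | nil => simp
  | cons b g ih =>
    rw [List.foldr_cons, List.map_cons, List.sum_cons]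
    refine sup_le ?_ (ih.trans (by exact_mod_cast Nat.le_add_left _ _))
    split_ifs
    · exact_mod_cast Nat.le_add_right _ _
    · exact bot_le

theorem RegionEquiv.sat {α : Bound X} {v w : Valuation X} (h : RegionEquiv α v w) {g : Guard X}
    (hg : guardBound g ≤ α) (hv : v.Sat g) : w.Sat g := by
  intro a ha
  have hc := (le_guardBound ha).trans (hg a.clock)
  have h1 : v a.clock < (a.const : ℝ≥0) ↔ w a.clock < (a.const : ℝ≥0) := by
    exact_mod_cast h.lt_iff _ _ hc
  have h2 : v a.clock ≤ (a.const : ℝ≥0) ↔ w a.clock ≤ (a.const : ℝ≥0) := by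
    exact_mod_cast h.le_iff _ _ hc
  have := hv a ha
  revert this
  cases a.cmp
  · exact h1.1
  · exact h2.1
  · intro hh
    exact le_antisymm (h2.1 hh.le) (not_lt.1 fun hlt => (h1.2 hlt).ne hh)
  · intro hh
    exact not_lt.1 fun hlt => (h1.2 hlt).not_ge hh
  · intro hh
    exact not_le.1 fun hle => (h2.2 hle).not_gt hh

/-- Reset clocks have the value `0` on both sides and lie in no open interval. They therefore never
enter a comparison of fractional parts, and `β` is unrestricted on them. -/
theorem RegionEquiv.resetTo {α β : Bound X} {R : Set X} {v w : Valuation X}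
    (h : RegionEquiv α v w) (hβ : ∀ x ∉ R, β x ≤ α x) :
    SameRegion β (v.resetTo R) (w.resetTo R) := by
  have zero {u : Valuation X} {x : X} (hx : x ∈ R) : u.resetTo R x = 0 := if_pos hx
  have same {u : Valuation X} {x : X} (hx : x ∉ R) : u.resetTo R x = u x := if_neg hx
  have not_zero {a : WithBot ℕ} {c : ℕ} : ¬ InInterval a c 0 := fun h0 => by
    have h1 : (1 : ℝ) ≤ c := by exact_mod_cast h0.1
    have h2 := h0.2.2.1
    simp only [NNReal.coe_zero] at h2
    linarith
  have lift {u : Valuation X} {x : X} {c : ℕ} (hu : InInterval (β x) c (u.resetTo R x)) :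
      x ∉ R ∧ InInterval (α x) c (u x) := by
    have hx : x ∉ R := fun hx => not_zero (zero hx ▸ hu)
    rw [same hx] at hu
    exact ⟨hx, hu.1, hu.2.1.trans (hβ x hx), hu.2.2⟩
  have hs := h.sameRegion
  refine ⟨fun x c hc => ?_, fun x c => ?_, ?_⟩
  · by_cases hx : x ∈ R
    · rw [zero hx, zero hx]
    · rw [same hx, same hx]
      exact hs.1 x c (hc.trans (hβ x hx))
  · constructor
    · intro hu
      obtain ⟨hx, hu'⟩ := lift hu
      rw [same hx]
      exact ⟨hu.1, hu.2.1, ((hs.2.1 x c).1 hu').2.2⟩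
    · intro hu
      obtain ⟨hx, hu'⟩ := lift hu
      rw [same hx]
      exact ⟨hu.1, hu.2.1, ((hs.2.1 x c).2 hu').2.2⟩
  · rintro x y ⟨c, hc⟩ ⟨d, hd⟩
    obtain ⟨hx, hc⟩ := lift hc
    obtain ⟨hy, hd⟩ := lift hd
    simp only [same hx, same hy]
    exact hs.2.2 x y ⟨c, hc⟩ ⟨d, hd⟩

/-- Region equivalence is a simulation as long as the bound functions respect `maxedge`. -/
theorem SameRegion.exists_fires [Finite X] {Q : Type*} {α β : Bound X} {t : Transition Q X}
    (hα : maxedge t.guard t.reset β ≤ α) {v v' w : Valuation X} (h : SameRegion α v w) {d : ℝ≥0}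
    (hv : t.Fires v d v') : ∃ d' w', t.Fires w d' w' ∧ SameRegion β v' w' := by
  obtain ⟨d', hd'⟩ := h.regionEquiv.exists_delay d
  refine ⟨d', _, ⟨hd'.sat (fun x => le_sup_right.trans (hα x)) hv.1, rfl⟩, ?_⟩
  rw [hv.2]
  refine hd'.resetTo fun x hx => le_trans ?_ (hα x)
  simp [maxedge, hx]

/-! ### Finitely many regions -/

/-- The truth values of the constraints that define the regions for bounds up to `N`. -/
abbrev RegionSignature (X : Type*) (N : ℕ) : Type _ :=
  (X → Fin (N + 1) → Prop × Prop) × (X → X → Prop × Prop)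

/-- The signature of a valuation. -/
def regionSignature (N : ℕ) (v : Valuation X) : RegionSignature X N :=
  (fun x c => (v x = (c : ℕ), (c : ℝ) - 1 < v x ∧ (v x : ℝ) < (c : ℕ)),
    fun x y => (Int.fract (v x : ℝ) < Int.fract (v y : ℝ),
      Int.fract (v x : ℝ) = Int.fract (v y : ℝ)))

/-- The signature does not mention `α`: one finite invariant serves all bound functions up to `N`,
and so remains usable while the bounds change. -/
theorem sameRegion_of_regionSignature_eq {N : ℕ} {α : Bound X} (hα : ∀ x, α x ≤ (N : WithBot ℕ))
    {v w : Valuation X} (h : regionSignature N v = regionSignature N w) : SameRegion α v w := by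
  have h1 (x : X) (c : ℕ) (hc : (c : WithBot ℕ) ≤ α x) :=
    congrFun (congrFun (congrArg Prod.fst h) x) ⟨c, Nat.lt_succ_of_le (by
      exact_mod_cast hc.trans (hα x))⟩
  have h2 (x y : X) := congrFun (congrFun (congrArg Prod.snd h) x) y
  simp only [regionSignature, Prod.mk.injEq, eq_iff_iff] at h1 h2
  exact ⟨fun x c hc => (h1 x c hc).1,
    fun x c => and_congr_right fun _ => and_congr_right fun hc => (h1 x c hc).2,
    fun x y _ _ => h2 x y⟩

theorem subset_closureAbs_of_image_subset {N : ℕ} {α : Bound X}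
    (hα : ∀ x, α x ≤ (N : WithBot ℕ)) {S T : Set (Valuation X)}
    (h : regionSignature N '' S ⊆ regionSignature N '' T) : S ⊆ closureAbs α T := fun v hv => by
  obtain ⟨w, hw, e⟩ := h ⟨v, hv, rfl⟩
  exact mem_closureAbs.2 ⟨w, hw, sameRegion_of_regionSignature_eq hα e.symm⟩

end Regions

/-! ### Elementary facts about stores and nodes -/

section Stores

variable {Q X : Type*}

open Classical in
theorem Store.setMark_mark (σ : Store Q X) (n k : Node Q X) (a : Mark Q X) :
    (σ.setMark n a).mark k = if k = n then a else σ.mark k :=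
  Function.update_apply _ _ _ _

open Classical in
theorem Store.setBound_bound (σ : Store Q X) (n k : Node Q X) (α : Bound X) :
    (σ.setBound n α).bound k = if k = n then α else σ.bound k :=
  Function.update_apply _ _ _ _

@[simp] theorem Store.setMark_bound (σ : Store Q X) (n : Node Q X) (a : Mark Q X) :
    (σ.setMark n a).bound = σ.bound := rfl

@[simp] theorem Store.setMark_stack (σ : Store Q X) (n : Node Q X) (a : Mark Q X) :
    (σ.setMark n a).stack = σ.stack := rfl

@[simp] theorem Store.setBound_mark (σ : Store Q X) (n : Node Q X) (α : Bound X) :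
    (σ.setBound n α).mark = σ.mark := rfl

theorem Store.setBound_bound_self (σ : Store Q X) (n : Node Q X) (α : Bound X) :
    (σ.setBound n α).bound n = α := by
  rw [Store.setBound_bound, if_pos rfl]

theorem Store.setBound_bound_of_ne (σ : Store Q X) {n k : Node Q X} (h : k ≠ n) (α : Bound X) :
    (σ.setBound n α).bound k = σ.bound k := by
  rw [Store.setBound_bound, if_neg h]

theorem Store.setMark_mark_self (σ : Store Q X) (n : Node Q X) (a : Mark Q X) :
    (σ.setMark n a).mark n = a := by
  rw [Store.setMark_mark, if_pos rfl]

theorem Store.setMark_mark_of_ne (σ : Store Q X) {n k : Node Q X} (h : k ≠ n) (a : Mark Q X) :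
    (σ.setMark n a).mark k = σ.mark k := by
  rw [Store.setMark_mark, if_neg h]

/-- The order on bound functions for increasing (`up`) and for decreasing propagation. -/
def DirLE (up : Bool) (α β : Bound X) : Prop := if up then α ≤ β else β ≤ α

theorem DirLE.of_eq {up : Bool} {α β : Bound X} (h : α = β) : DirLE up α β := by
  subst h
  cases up <;> simp [DirLE]

theorem DirLE.trans {up : Bool} {α β γ : Bound X} (h : DirLE up α β) (h' : DirLE up β γ) :
    DirLE up α γ := by
  cases up
  · exact le_trans (α := Bound X) h' h
  · exact le_trans (α := Bound X) h h'

theorem maxedge_mono (g : Guard X) (R : Set X) {α β : Bound X} (h : α ≤ β) :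
    maxedge g R α ≤ maxedge g R β := fun x => by
  unfold maxedge
  refine sup_le_sup ?_ le_rfl
  split_ifs
  · exact le_rfl
  · exact h x

namespace TimedAutomaton

variable (A : TimedAutomaton Q X)

variable {A} in
theorem tail_eq_of_mem_children {m n : Node Q X} (h : m ∈ A.children n) : m.tail = n := by
  obtain ⟨t, -, -, rfl⟩ := h
  rfl

variable {A} in
theorem ne_nil_of_mem_children {m n : Node Q X} (h : m ∈ A.children n) : m ≠ [] := by
  obtain ⟨t, -, -, rfl⟩ := h
  simp

theorem finite_children (n : Node Q X) : (A.children n).Finite := by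
  refine (A.trans.finite_toSet.image (fun t => t :: n)).subset ?_
  rintro _ ⟨t, ht, -, rfl⟩
  exact ⟨t, ht, rfl⟩

/-! ### Monotonicity and range of the bounds required by children -/

theorem childrenBound_mono {σ τ : Store Q X} (n : Node Q X)
    (h : ∀ m ∈ A.children n, σ.bound m ≤ τ.bound m) :
    A.childrenBound σ n ≤ A.childrenBound τ n := by
  classical
  refine Finset.sup_mono_fun fun t ht => maxedge_mono _ _ (h _ ?_)
  rw [Finset.mem_filter] at ht
  exact ⟨t, ht.1, ht.2, rfl⟩

theorem childrenBound_congr {σ τ : Store Q X} (n : Node Q X)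
    (h : ∀ m ∈ A.children n, σ.bound m = τ.bound m) :
    A.childrenBound σ n = A.childrenBound τ n :=
  le_antisymm (A.childrenBound_mono n fun m hm => (h m hm).le)
    (A.childrenBound_mono n fun m hm => (h m hm).ge)

theorem maxedge_le_childrenBound (σ : Store Q X) {n : Node Q X} {t : Transition Q X}
    (ht : t ∈ A.trans) (hs : t.src = A.nodeState n) :
    maxedge t.guard t.reset (σ.bound (t :: n)) ≤ A.childrenBound σ n := by
  classical
  exact Finset.le_sup (f := fun t : Transition Q X => maxedge t.guard t.reset (σ.bound (t :: n)))
    (Finset.mem_filter.2 ⟨ht, hs⟩)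

theorem childrenBound_setBound_of_notMem (σ : Store Q X) {n m : Node Q X} (β : Bound X)
    (h : m ∉ A.children n) : A.childrenBound (σ.setBound m β) n = A.childrenBound σ n :=
  A.childrenBound_congr n fun _ hk =>
    σ.setBound_bound_of_ne (fun e => h (by subst e; exact hk)) β

theorem childrenBound_setBound_self (σ : Store Q X) (n : Node Q X) (β : Bound X) :
    A.childrenBound (σ.setBound n β) n = A.childrenBound σ n := by
  refine A.childrenBound_setBound_of_notMem σ β ?_
  rintro ⟨t, -, -, h⟩
  exact absurd (congrArg List.length h) (by simp)

theorem DirLE_childrenBound_setBound {up : Bool} (σ : Store Q X) {n m : Node Q X} {β : Bound X}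
    (h : DirLE up (σ.bound m) β) :
    DirLE up (A.childrenBound σ n) (A.childrenBound (σ.setBound m β) n) := by
  cases up
  · refine A.childrenBound_mono n fun k _ => ?_
    rw [Store.setBound_bound]
    split_ifs with e
    · subst e; exact h
    · exact le_rfl
  · refine A.childrenBound_mono n fun k _ => ?_
    rw [Store.setBound_bound]
    split_ifs with e
    · subst e; exact h
    · exact le_rfl

/-- `N` is an upper bound for the constants that occur in the guards. -/
def GuardsBoundedBy (N : ℕ) : Prop :=
  ∀ t ∈ A.trans, ∀ x, guardBound t.guard x ≤ (N : WithBot ℕ)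

theorem exists_guardsBoundedBy : ∃ N, A.GuardsBoundedBy N := by
  refine ⟨∑ t ∈ A.trans, (t.guard.map Atom.const).sum, fun t ht x => ?_⟩
  refine (guardBound_le_sum t.guard x).trans ?_
  exact_mod_cast Finset.single_le_sum (f := fun t : Transition Q X =>
    (t.guard.map Atom.const).sum) (fun _ _ => Nat.zero_le _) ht

variable {A} in
theorem GuardsBoundedBy.childrenBound_le {N : ℕ} (hN : A.GuardsBoundedBy N) {σ : Store Q X}
    (h : ∀ n x, σ.bound n x ≤ (N : WithBot ℕ)) (n : Node Q X) (x : X) :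
    A.childrenBound σ n x ≤ (N : WithBot ℕ) := by
  classical
  have : A.childrenBound σ n ≤ fun _ => (N : WithBot ℕ) := by
    refine Finset.sup_le fun t ht x => sup_le ?_ (hN t (Finset.mem_filter.1 ht).1 x)
    split_ifs
    · exact bot_le
    · exact h _ x
  exact this x

/-! ### Marks -/

/-- The root and the children of the nontentative nodes: these are the nodes of the tree that
the algorithm has built. -/
def InTree (mark : Node Q X → Mark Q X) (n : Node Q X) : Prop :=
  n = [] ∨ ∃ m, mark m = .nontentative ∧ n ∈ A.children m

/-- The zone of a node up to regions, together with its state. -/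
def nodeKey (N : ℕ) (n : Node Q X) : Q × Set (RegionSignature X N) :=
  (A.nodeState n, regionSignature N '' A.nodeZone n)

/-- The invariants of the marks and of the range of the bound functions. -/
structure MarkInv (N : ℕ) (σ : Store Q X) : Prop where
  inTree : ∀ n, σ.mark n ≠ .unexplored → A.InTree σ.mark n
  nonempty : ∀ n, σ.mark n ≠ .unexplored → (A.nodeZone n).Nonempty
  cover : ∀ n m, σ.mark n = .tentative m →
    σ.mark m = .nontentative ∧ A.nodeState m = A.nodeState n
  notAccepting : ∀ n, σ.mark n = .nontentative → A.nodeState n ∉ A.accepting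
  key_injOn : ∀ n m, σ.mark n = .nontentative → σ.mark m = .nontentative →
    A.nodeKey N n = A.nodeKey N m → n = m
  bound_eq_bot : ∀ n, σ.mark n = .unexplored → σ.bound n = ⊥
  bound_le : ∀ n x, σ.bound n x ≤ (N : WithBot ℕ)

variable {A}

namespace MarkInv

variable {N : ℕ} {σ : Store Q X}

/-- Every ancestor of a nontentative node is nontentative. In particular nothing can cover an
unexplored root, so the root is never tentative and `n.tail` is a true parent wherever a tentative
`n` triggers propagation. -/
theorem root (h : A.MarkInv N σ) {n : Node Q X} (hn : σ.mark n = .nontentative) :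
    σ.mark [] = .nontentative := by
  induction n with
  | nil => exact hn
  | cons t n ih =>
    rcases h.inTree (t :: n) (by rw [hn]; simp) with h0 | ⟨m, hm, hc⟩
    · cases h0
    · rw [← tail_eq_of_mem_children hc] at hm
      exact ih hm

theorem parent (h : A.MarkInv N σ) {n : Node Q X} (hn : σ.mark n ≠ .unexplored)
    (h0 : n ≠ []) : σ.mark n.tail = .nontentative := by
  rcases h.inTree n hn with h1 | ⟨m, hm, hc⟩
  · exact absurd h1 h0
  · rwa [tail_eq_of_mem_children hc]

theorem tentative_ne_nil (h : A.MarkInv N σ) {n m : Node Q X} (hn : σ.mark n = .tentative m) :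
    n ≠ [] := by
  rintro rfl
  have := h.root (h.cover _ _ hn).1
  rw [hn] at this
  cases this

theorem reachable (h : A.MarkInv N σ) {n : Node Q X} (hn : σ.mark n = .nontentative) :
    Relation.ReflTransGen A.ZoneEdge (A.start, initialZone X) (A.nodeState n, A.nodeZone n) := by
  induction n with
  | nil => exact .refl
  | cons t n ih =>
    rcases h.inTree (t :: n) (by rw [hn]; simp) with h0 | ⟨m, hm, s, hs, hsrc, e⟩
    · cases h0
    · obtain ⟨rfl, rfl⟩ := List.cons.inj e
      exact (ih hm).tail ⟨t, hs, hsrc, rfl, rfl⟩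

theorem acceptingReachable (h : A.MarkInv N σ) {n : Node Q X} (hn : A.InTree σ.mark n)
    (ha : A.nodeState n ∈ A.accepting) (hz : (A.nodeZone n).Nonempty) :
    A.AcceptingReachable := by
  refine ⟨_, _, ?_, ha, hz⟩
  rcases hn with rfl | ⟨m, hm, t, ht, hsrc, rfl⟩
  · exact .refl
  · exact (h.reachable hm).tail ⟨t, ht, hsrc, rfl, rfl⟩

/-- Nodes are arbitrary lists of transitions, but nontentative ones are separated by their keys,
which range over a finite type. -/
theorem finite_nontentative [Finite Q] [Finite X] (h : A.MarkInv N σ) :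
    {n | σ.mark n = .nontentative}.Finite :=
  Set.Finite.of_injOn (f := A.nodeKey N) (t := Set.univ) (fun _ _ => Set.mem_univ _)
    (fun _ hn _ hm e => h.key_injOn _ _ hn hm e) Set.finite_univ

theorem ncard_nontentative_le [Finite Q] [Finite X] (h : A.MarkInv N σ) :
    {n | σ.mark n = .nontentative}.ncard ≤ Nat.card (Q × Set (RegionSignature X N)) := by
  rw [← Set.ncard_univ]
  exact Set.ncard_le_ncard_of_injOn (A.nodeKey N) (fun _ _ => Set.mem_univ _)
    (fun _ hn _ hm e => h.key_injOn _ _ hn hm e)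

theorem finite_inTree [Finite Q] [Finite X] (h : A.MarkInv N σ) :
    {n | A.InTree σ.mark n}.Finite := by
  refine ((Set.finite_singleton []).union
    (h.finite_nontentative.biUnion fun m _ => A.finite_children m)).subset ?_
  rintro n (rfl | ⟨m, hm, hc⟩)
  · exact .inl rfl
  · exact .inr (Set.mem_biUnion hm hc)

theorem finite_of_tentative [Finite Q] [Finite X] (h : A.MarkInv N σ) {S : Set (Node Q X)}
    (hS : ∀ n ∈ S, ∃ m, σ.mark n = .tentative m) : S.Finite :=
  h.finite_inTree.subset fun n hn => by
    obtain ⟨m, hm⟩ := hS n hn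
    exact h.inTree n (by rw [hm]; simp)

theorem setBound (h : A.MarkInv N σ) {n : Node Q X} (hn : σ.mark n ≠ .unexplored)
    {β : Bound X} (hβ : ∀ x, β x ≤ (N : WithBot ℕ)) : A.MarkInv N (σ.setBound n β) where
  inTree := h.inTree
  nonempty := h.nonempty
  cover := h.cover
  notAccepting := h.notAccepting
  key_injOn := h.key_injOn
  bound_eq_bot k hk := by
    rw [Store.setBound_bound_of_ne _ (by rintro rfl; exact hn hk)]
    exact h.bound_eq_bot k hk
  bound_le k x := by
    rw [Store.setBound_bound]
    split_ifs
    · exact hβ x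
    · exact h.bound_le k x

end MarkInv

end TimedAutomaton

end Stores

/-! ### Propagation -/

section Propagation

variable {Q X : Type*}

/-- The frames of the calls of `propagate`. -/
inductive PropFrame (Q X : Type*) where
  | call (n : Node Q X)
  | loop (n : Node Q X) (S : Set (Node Q X))

/-- The corresponding frame of the call stack. -/
def PropFrame.toFrame : PropFrame Q X → Frame Q X
  | .call n => .propagate n
  | .loop n S => .propagateLoop n S

/-- A bound for the number of steps that a frame takes as long as no bound function changes. -/
noncomputable def PropFrame.weight : PropFrame Q X → ℕ
  | .call _ => 1
  | .loop _ S => 2 * S.ncard + 2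

/-- The invariants of propagation: the bound functions move monotonically, and any bound
function that is not up to date is going to be updated. -/
structure PropInv (A : TimedAutomaton Q X) (up : Bool) (σ : Store Q X)
    (P : List (PropFrame Q X)) : Prop where
  call_mark : ∀ n, .call n ∈ P → σ.mark n = .nontentative
  loop_mark : ∀ n S, .loop n S ∈ P → σ.mark n = .nontentative ∧
    ∀ m ∈ S, σ.mark m = .tentative n
  nontentative_dir : ∀ n, σ.mark n = .nontentative → DirLE up (σ.bound n) (A.childrenBound σ n)
  tentative_dir : ∀ m n, σ.mark m = .tentative n → DirLE up (σ.bound m) (σ.bound n)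
  nontentative_eq : ∀ n, σ.mark n = .nontentative → σ.bound n = A.childrenBound σ n ∨
    .call n ∈ P ∨ ∃ m S, .loop m S ∈ P ∧ m ≠ [] ∧ m.tail = n
  tentative_eq : ∀ m n, σ.mark m = .tentative n → σ.bound m = σ.bound n ∨
    ∃ S, .loop n S ∈ P ∧ m ∈ S

namespace PropInv

variable {A : TimedAutomaton Q X} {up : Bool} {σ : Store Q X} {P : List (PropFrame Q X)}

theorem eq_childrenBound (h : PropInv A up σ []) {n : Node Q X}
    (hn : σ.mark n = .nontentative) : σ.bound n = A.childrenBound σ n := by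
  simpa using h.nontentative_eq n hn

theorem eq_cover (h : PropInv A up σ []) {m n : Node Q X} (hm : σ.mark m = .tentative n) :
    σ.bound m = σ.bound n := by
  simpa using h.tentative_eq m n hm

theorem of_eq (h1 : ∀ n, σ.mark n = .nontentative → σ.bound n = A.childrenBound σ n)
    (h2 : ∀ m n, σ.mark m = .tentative n → σ.bound m = σ.bound n) : PropInv A up σ [] where
  call_mark := by simp
  loop_mark := by simp
  nontentative_dir n hn := .of_eq (h1 n hn)
  tentative_dir m n hm := .of_eq (h2 m n hm)
  nontentative_eq n hn := .inl (h1 n hn)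
  tentative_eq m n hm := .inl (h2 m n hm)

/-- With nothing pending, the inequalities are equalities and have no direction. This permits the
switch between exploring and resolving. -/
theorem change_dir (h : PropInv A up σ []) (up' : Bool) : PropInv A up' σ [] :=
  .of_eq (fun _ => h.eq_childrenBound) (fun _ _ => h.eq_cover)

theorem same {n : Node Q X} (h : PropInv A up σ (.call n :: P))
    (hn : A.childrenBound σ n = σ.bound n) : PropInv A up σ P where
  call_mark k hk := h.call_mark k (List.mem_cons_of_mem _ hk)
  loop_mark k S hk := h.loop_mark k S (List.mem_cons_of_mem _ hk)
  nontentative_dir := h.nontentative_dir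
  tentative_dir := h.tentative_dir
  nontentative_eq k hk := by
    rcases h.nontentative_eq k hk with h1 | h1 | ⟨m, S, h1, h2⟩
    · exact .inl h1
    · rcases List.mem_cons.1 h1 with h2 | h2
      · cases h2
        exact .inl hn.symm
      · exact .inr (.inl h2)
    · exact .inr (.inr ⟨m, S, by simpa using h1, h2⟩)
  tentative_eq m k hm := by
    simpa using h.tentative_eq m k hm

/-- The update of `n` can only outdate its parent and the nodes tentative with respect to `n`. The
new loop covers both: it treats those nodes and afterwards calls the parent. Directions persist
since `childrenBound` is monotone. -/
theorem change {n : Node Q X}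
    (h : PropInv A up σ (.call n :: P)) :
    PropInv A up (σ.setBound n (A.childrenBound σ n))
      (.loop n {m | σ.mark m = .tentative n} :: P) := by
  have hn : σ.mark n = .nontentative := h.call_mark n (by simp)
  have hdir := h.nontentative_dir n hn
  have hne {m k : Node Q X} (hm : σ.mark m = .tentative k) : m ≠ n := by
    rintro rfl
    rw [hn] at hm
    cases hm
  refine ⟨?_, ?_, ?_, ?_, ?_, ?_⟩
  · intro k hk
    exact h.call_mark k (by simp at hk ⊢; exact .inr hk)
  · intro k S hk
    rcases List.mem_cons.1 hk with e | hk
    · cases e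
      exact ⟨hn, fun m hm => hm⟩
    · exact h.loop_mark k S (List.mem_cons_of_mem _ hk)
  · intro k hk
    refine DirLE.trans ?_ (A.DirLE_childrenBound_setBound σ hdir)
    rw [Store.setBound_bound]
    split_ifs with e
    · rw [e]; exact .of_eq rfl
    · exact h.nontentative_dir k hk
  · intro m k hm
    rw [Store.setBound_bound_of_ne _ (hne hm), Store.setBound_bound]
    refine (h.tentative_dir m k hm).trans ?_
    split_ifs with e
    · rw [e]; exact hdir
    · exact .of_eq rfl
  · intro k hk
    by_cases e : k = n
    · subst e
      left
      rw [Store.setBound_bound_self, A.childrenBound_setBound_self]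
    by_cases hc : n ∈ A.children k
    · exact .inr (.inr ⟨n, _, List.mem_cons_self, TimedAutomaton.ne_nil_of_mem_children hc,
        TimedAutomaton.tail_eq_of_mem_children hc⟩)
    rw [Store.setBound_bound_of_ne _ e, A.childrenBound_setBound_of_notMem σ _ hc]
    rcases h.nontentative_eq k hk with h1 | h1 | ⟨m, S, h1, h2⟩
    · exact .inl h1
    · right; left
      simp only [List.mem_cons, PropFrame.call.injEq, e, false_or] at h1
      exact List.mem_cons_of_mem _ h1
    · exact .inr (.inr ⟨m, S, List.mem_cons_of_mem _ (by simpa using h1), h2⟩)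
  · intro m k hm
    by_cases e : k = n
    · subst e
      exact .inr ⟨_, List.mem_cons_self, hm⟩
    rw [Store.setBound_bound_of_ne _ (hne hm), Store.setBound_bound_of_ne _ e]
    rcases h.tentative_eq m k hm with h1 | ⟨S, h1, h2⟩
    · exact .inl h1
    · exact .inr ⟨S, List.mem_cons_of_mem _ (by simpa using h1), h2⟩

/-- Since `m` is tentative, it covers no node. Its update can only outdate its parent, for which the
call is added. -/
theorem next {N : ℕ} (hM : A.MarkInv N σ) {n m : Node Q X} {S : Set (Node Q X)} (hm : m ∈ S)
    (h : PropInv A up σ (.loop n S :: P)) :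
    PropInv A up (σ.setBound m (σ.bound n)) (.call m.tail :: .loop n (S \ {m}) :: P) := by
  obtain ⟨hn, hS⟩ := h.loop_mark n S List.mem_cons_self
  have hmn := hS m hm
  have hm0 := hM.tentative_ne_nil hmn
  have hdir := h.tentative_dir m n hmn
  have hne {k : Node Q X} (hk : σ.mark k = .nontentative) : k ≠ m := by
    rintro rfl
    rw [hmn] at hk
    cases hk
  refine ⟨?_, ?_, ?_, ?_, ?_, ?_⟩
  · intro k hk
    rcases List.mem_cons.1 hk with e | hk
    · cases e
      exact hM.parent (by rw [hmn]; simp) hm0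
    · exact h.call_mark k (by simpa using hk)
  · intro k T hk
    simp only [List.mem_cons, reduceCtorEq, PropFrame.loop.injEq, false_or] at hk
    rcases hk with ⟨rfl, rfl⟩ | hk
    · exact ⟨hn, fun k hk => hS k hk.1⟩
    · exact h.loop_mark k T (List.mem_cons_of_mem _ hk)
  · intro k hk
    rw [Store.setBound_bound_of_ne _ (hne hk)]
    exact (h.nontentative_dir k hk).trans (A.DirLE_childrenBound_setBound σ hdir)
  · intro k l hk
    rw [Store.setBound_bound_of_ne _ (hne (hM.cover k l hk).1), Store.setBound_bound]
    split_ifs with e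
    · subst e
      rw [Store.setBound_mark, hmn] at hk
      cases hk
      exact .of_eq rfl
    · exact h.tentative_dir k l hk
  · intro k hk
    by_cases hc : m ∈ A.children k
    · rw [← TimedAutomaton.tail_eq_of_mem_children hc]
      exact .inr (.inl List.mem_cons_self)
    rw [Store.setBound_bound_of_ne _ (hne hk), A.childrenBound_setBound_of_notMem σ _ hc]
    rcases h.nontentative_eq k hk with h1 | h1 | ⟨l, T, h1, h2⟩
    · exact .inl h1
    · right; left
      simp only [List.mem_cons, reduceCtorEq, false_or] at h1
      exact List.mem_cons_of_mem _ (List.mem_cons_of_mem _ h1)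
    · right; right
      simp only [List.mem_cons, PropFrame.loop.injEq] at h1
      rcases h1 with ⟨rfl, rfl⟩ | h1
      · exact ⟨l, _, by simp; left; rfl, h2⟩
      · exact ⟨l, T, List.mem_cons_of_mem _ (List.mem_cons_of_mem _ h1), h2⟩
  · intro k l hk
    rw [Store.setBound_bound_of_ne _ (hne (hM.cover k l hk).1), Store.setBound_bound]
    split_ifs with e
    · subst e
      rw [Store.setBound_mark, hmn] at hk
      cases hk
      exact .inl rfl
    · rcases h.tentative_eq k l hk with h1 | ⟨T, h1, h2⟩
      · exact .inl h1
      · right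
        simp only [List.mem_cons, PropFrame.loop.injEq] at h1
        rcases h1 with ⟨rfl, rfl⟩ | h1
        · exact ⟨_, List.mem_cons_of_mem _ List.mem_cons_self, h2, e⟩
        · exact ⟨T, List.mem_cons_of_mem _ (List.mem_cons_of_mem _ h1), h2⟩

theorem loopUp {N : ℕ} (hM : A.MarkInv N σ) {n : Node Q X} (h0 : n ≠ [])
    (h : PropInv A up σ (.loop n ∅ :: P)) : PropInv A up σ (.call n.tail :: P) where
  call_mark k hk := by
    rcases List.mem_cons.1 hk with e | hk
    · cases e
      exact hM.parent (by rw [(h.loop_mark n ∅ List.mem_cons_self).1]; simp) h0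
    · exact h.call_mark k (List.mem_cons_of_mem _ hk)
  loop_mark k S hk := h.loop_mark k S (List.mem_cons_of_mem _ (by simpa using hk))
  nontentative_dir := h.nontentative_dir
  tentative_dir := h.tentative_dir
  nontentative_eq k hk := by
    rcases h.nontentative_eq k hk with h1 | h1 | ⟨m, S, h1, h2, h3⟩
    · exact .inl h1
    · exact .inr (.inl (List.mem_cons_of_mem _ (by simpa using h1)))
    · right
      rcases List.mem_cons.1 h1 with e | h1
      · cases e
        rw [← h3]
        exact .inl List.mem_cons_self
      · exact .inr ⟨m, S, List.mem_cons_of_mem _ h1, h2, h3⟩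
  tentative_eq m k hm := by
    rcases h.tentative_eq m k hm with h1 | ⟨S, h1, h2⟩
    · exact .inl h1
    · right
      rcases List.mem_cons.1 h1 with e | h1
      · cases e
        exact absurd h2 (Set.notMem_empty _)
      · exact ⟨S, List.mem_cons_of_mem _ h1, h2⟩

/-- No repair is lost: the clause `m ≠ []` in `nontentative_eq` prevents the loop of the root from
counting as a promise to call `[].tail = []`. -/
theorem loopRoot (h : PropInv A up σ (.loop [] ∅ :: P)) : PropInv A up σ P where
  call_mark k hk := h.call_mark k (List.mem_cons_of_mem _ hk)
  loop_mark k S hk := h.loop_mark k S (List.mem_cons_of_mem _ hk)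
  nontentative_dir := h.nontentative_dir
  tentative_dir := h.tentative_dir
  nontentative_eq k hk := by
    rcases h.nontentative_eq k hk with h1 | h1 | ⟨m, S, h1, h2, h3⟩
    · exact .inl h1
    · exact .inr (.inl (by simpa using h1))
    · rcases List.mem_cons.1 h1 with e | h1
      · cases e
        exact absurd rfl h2
      · exact .inr (.inr ⟨m, S, h1, h2, h3⟩)
  tentative_eq m k hm := by
    rcases h.tentative_eq m k hm with h1 | ⟨S, h1, h2⟩
    · exact .inl h1
    · right
      rcases List.mem_cons.1 h1 with e | h1
      · cases e
        exact absurd h2 (Set.notMem_empty _)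
      · exact ⟨S, h1, h2⟩

end PropInv

/-! ### The potential that decreases with every change of a bound function -/

/-- The pairs of clocks and constants that the bound functions of the nontentative nodes can
still change at. -/
def changeable (N : ℕ) (up : Bool) (σ : Store Q X) : Set (Node Q X × X × ℕ) :=
  {p | σ.mark p.1 = .nontentative ∧ p.2.2 ≤ N ∧
    ((p.2.2 : WithBot ℕ) ≤ σ.bound p.1 p.2.1 ↔ up = false)}

/-- The number of possible changes of bound functions. -/
noncomputable def potential (N : ℕ) (up : Bool) (σ : Store Q X) : ℕ :=
  (changeable N up σ).ncard

theorem finite_changeable [Finite Q] [Finite X] {A : TimedAutomaton Q X} {N : ℕ} (up : Bool)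
    {σ : Store Q X} (hM : A.MarkInv N σ) : (changeable N up σ).Finite := by
  refine (hM.finite_nontentative.prod (Set.finite_univ.prod (Set.finite_Iic N))).subset ?_
  rintro ⟨n, x, c⟩ ⟨h1, h2, -⟩
  exact ⟨h1, Set.mem_univ _, h2⟩

theorem changeable_setBound_subset {N : ℕ} {up : Bool} {σ : Store Q X} {n : Node Q X}
    {β : Bound X} (h : DirLE up (σ.bound n) β) :
    changeable N up (σ.setBound n β) ⊆ changeable N up σ := by
  rintro ⟨k, x, c⟩ ⟨h1, h2, h3⟩
  refine ⟨h1, h2, ?_⟩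
  rw [Store.setBound_bound] at h3
  split_ifs at h3 with e
  · simp only at e
    subst e
    cases up
    · exact ⟨fun _ => rfl, fun _ => (h3.2 rfl).trans (h x)⟩
    · have : ¬ (c : WithBot ℕ) ≤ β x := fun h' => by simpa using h3.1 h'
      exact ⟨fun h' => absurd (h'.trans (h x)) this, fun h' => by simp at h'⟩
  · exact h3

theorem potential_setBound_le [Finite Q] [Finite X] {A : TimedAutomaton Q X} {N : ℕ} {up : Bool}
    {σ : Store Q X} (hM : A.MarkInv N σ) {n : Node Q X} {β : Bound X}
    (h : DirLE up (σ.bound n) β) : potential N up (σ.setBound n β) ≤ potential N up σ :=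
  Set.ncard_le_ncard (changeable_setBound_subset h) (finite_changeable up hM)

/-- Values up to `N` are determined by the naturals below them, `⊥` being the value with none. Hence
every proper change of a bound is seen by `changeable`. -/
theorem exists_natCast_of_lt {a b : WithBot ℕ} {N : ℕ} (hb : b ≤ N) (h : ¬ b ≤ a) :
    ∃ c : ℕ, c ≤ N ∧ (c : WithBot ℕ) ≤ b ∧ ¬ (c : WithBot ℕ) ≤ a := by
  cases b using WithBot.recBotCoe with
  | bot => simp at h
  | coe c => exact ⟨c, WithBot.coe_le_coe.1 hb, le_rfl, h⟩

theorem potential_setBound_lt [Finite Q] [Finite X] {A : TimedAutomaton Q X} {N : ℕ} {up : Bool}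
    {σ : Store Q X} (hM : A.MarkInv N σ) {n : Node Q X} (hn : σ.mark n = .nontentative)
    {β : Bound X} (hβ : ∀ x, β x ≤ (N : WithBot ℕ)) (h : DirLE up (σ.bound n) β)
    (hne : β ≠ σ.bound n) : potential N up (σ.setBound n β) < potential N up σ := by
  refine Set.ncard_lt_ncard ?_ (finite_changeable up hM)
  refine ⟨changeable_setBound_subset h, fun hsub => hne ?_⟩
  have key (x : X) (c : ℕ) (hc : c ≤ N) :
      (c : WithBot ℕ) ≤ β x ↔ (c : WithBot ℕ) ≤ σ.bound n x := by
    have h1 : (n, x, c) ∈ changeable N up (σ.setBound n β) ↔ (n, x, c) ∈ changeable N up σ :=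
      ⟨fun h' => changeable_setBound_subset h h', fun h' => hsub h'⟩
    simp only [changeable, Set.mem_ofPred_eq, Store.setBound_mark, hn, hc, true_and,
      Store.setBound_bound_self] at h1
    cases up
    · simpa using h1
    · simpa [not_lt, ← not_le, not_iff_not] using h1
  funext x
  apply le_antisymm
  · by_contra hlt
    obtain ⟨c, hc, h1, h2⟩ := exists_natCast_of_lt (hβ x) hlt
    exact h2 ((key x c hc).1 h1)
  · by_contra hlt
    obtain ⟨c, hc, h1, h2⟩ := exists_natCast_of_lt (hM.bound_le n x) hlt
    exact h2 ((key x c hc).2 h1)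

theorem potential_congr {N : ℕ} {up : Bool} {σ τ : Store Q X}
    (h1 : ∀ n, τ.mark n = .nontentative ↔ σ.mark n = .nontentative)
    (h2 : ∀ n, σ.mark n = .nontentative → τ.bound n = σ.bound n) :
    potential N up τ = potential N up σ := by
  unfold potential
  congr 1
  ext ⟨n, x, c⟩
  simp only [changeable, Set.mem_ofPred_eq, h1]
  refine and_congr_right fun hn => ?_
  rw [h2 n hn]

/-- A step of propagation. -/
theorem propagation_step [Finite Q] [Finite X] {A : TimedAutomaton Q X} {N : ℕ}
    (hN : A.GuardsBoundedBy N) {up : Bool} {σ : Store Q X} {p : PropFrame Q X}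
    {P : List (PropFrame Q X)} {k : List (Frame Q X)} {c : Config Q X} (hM : A.MarkInv N σ)
    (hP : PropInv A up σ (p :: P)) (h : A.Step (.run σ (p.toFrame :: k)) c) :
    ∃ σ' P', c = .run σ' (P'.map PropFrame.toFrame ++ k) ∧ σ'.mark = σ.mark ∧
      σ'.stack = σ.stack ∧ A.MarkInv N σ' ∧ PropInv A up σ' (P' ++ P) ∧
      (∀ n, DirLE up (σ.bound n) (σ'.bound n)) ∧
      (potential N up σ' < potential N up σ ∨ potential N up σ' ≤ potential N up σ ∧
        (P'.map PropFrame.weight).sum < p.weight) := by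
  have dir {n : Node Q X} {β : Bound X} (hβ : DirLE up (σ.bound n) β) (m : Node Q X) :
      DirLE up (σ.bound m) ((σ.setBound n β).bound m) := by
    rw [Store.setBound_bound]
    split_ifs with e
    · rw [e]; exact hβ
    · exact .of_eq rfl
  cases p with
  | call n =>
    have hn := hP.call_mark n List.mem_cons_self
    cases h with
    | propagateSame _ _ _ h =>
      exact ⟨σ, [], rfl, rfl, rfl, hM, hP.same h, fun _ => .of_eq rfl,
        .inr ⟨le_rfl, by simp [PropFrame.weight]⟩⟩
    | propagateChange _ _ _ h =>
      have hd := hP.nontentative_dir n hn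
      have hb := hN.childrenBound_le hM.bound_le n
      exact ⟨_, [.loop n _], rfl, rfl, rfl, hM.setBound (by rw [hn]; simp) hb, hP.change,
        dir hd, .inl (potential_setBound_lt hM hn hb hd h)⟩
  | loop n S =>
    obtain ⟨hn, hS⟩ := hP.loop_mark n S List.mem_cons_self
    cases h with
    | propagateLoopNext _ _ _ m _ hm =>
      have hmn := hS m hm
      have hd := hP.tentative_dir m n hmn
      have hfin : S.Finite := hM.finite_of_tentative fun m hm => ⟨n, hS m hm⟩
      have hcard := Set.ncard_sdiff_singleton_lt_of_mem hm hfin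
      refine ⟨_, [.call m.tail, .loop n (S \ {m})], rfl, rfl, rfl,
        hM.setBound (by rw [hmn]; simp) (hM.bound_le n), hP.next hM hm, dir hd,
        .inr ⟨potential_setBound_le hM hd, ?_⟩⟩
      simp only [List.map_cons, List.map_nil, List.sum_cons, List.sum_nil, PropFrame.weight]
      omega
    | propagateLoopUp _ _ _ h =>
      refine ⟨σ, [.call n.tail], rfl, rfl, rfl, hM, hP.loopUp hM h, fun _ => .of_eq rfl,
        .inr ⟨le_rfl, ?_⟩⟩
      simp [PropFrame.weight]
    | propagateLoopRoot =>
      exact ⟨σ, [], rfl, rfl, rfl, hM, hP.loopRoot, fun _ => .of_eq rfl,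
        .inr ⟨le_rfl, by simp [PropFrame.weight]⟩⟩

end Propagation

/-! ### The control stack -/

section Control

variable {Q X : Type*}

/-- The part of the call stack below the calls of `propagate`. -/
inductive Ctrl (Q X : Type*) where
  /-- the main loop -/
  | main
  /-- a call of `explore`, with the pending loops over children -/
  | explore (n : Node Q X) (Ls : List (Set (Node Q X)))
  /-- the pending loops over children -/
  | loop (Ls : List (Set (Node Q X)))
  /-- the loop of `resolve` -/
  | resolving (S : Set (Node Q X))
  /-- a node is going to be pushed on the stack during the loop of `resolve` -/
  | pushing (n : Node Q X) (S : Set (Node Q X))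

namespace Ctrl

/-- The frames of the call stack. -/
def frames : Ctrl Q X → List (Frame Q X)
  | main => [.main]
  | explore n Ls => .explore n :: (Ls.map .exploreLoop ++ [.resolve, .main])
  | loop Ls => Ls.map .exploreLoop ++ [.resolve, .main]
  | resolving S => [.resolveLoop S, .main]
  | pushing n S => [.push n, .resolveLoop S, .main]

/-- Whether the bound functions increase. -/
def up : Ctrl Q X → Bool
  | explore _ _ | loop _ => true
  | _ => false

/-- Whether calls of `propagate` can be pending. -/
def Propagates : Ctrl Q X → Prop
  | main | explore _ _ => False
  | _ => True

/-- The phases of a round of the main loop, the last one being `0`. -/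
def phase : Ctrl Q X → ℕ
  | explore _ _ | loop _ => 0
  | main => 1
  | _ => 2

/-- A bound for the number of steps as long as no node becomes nontentative and no bound
function changes. -/
noncomputable def weight : Ctrl Q X → ℕ
  | main => 0
  | explore _ Ls => 2 + (Ls.map fun L => 4 * L.ncard + 1).sum
  | loop Ls => (Ls.map fun L => 4 * L.ncard + 1).sum
  | resolving S => 4 * S.ncard + 1
  | pushing _ S => 4 * S.ncard + 2

open Classical in
/-- The number of times that a node waits for being explored in the pending loops. -/
noncomputable def loopCount (Ls : List (Set (Node Q X))) (n : Node Q X) : ℕ :=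
  (Ls.map fun L => if n ∈ L then 1 else 0).sum

open Classical in
/-- The number of times that a node waits for being explored. -/
noncomputable def count : Ctrl Q X → Node Q X → ℕ
  | explore m Ls, n => (if n = m then 1 else 0) + loopCount Ls n
  | loop Ls, n => loopCount Ls n
  | pushing m _, n => if n = m then 1 else 0
  | _, _ => 0

end Ctrl

open Classical in
/-- The number of times that a node waits for being explored, including the stack. -/
noncomputable def pendCount (s : List (Node Q X)) (C : Ctrl Q X) (n : Node Q X) : ℕ :=
  s.count n + C.count n

/-- During the loop of `resolve` over the items `S`, the other tentative nodes are subsumed. -/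
def ResolveInv (A : TimedAutomaton Q X) (σ : Store Q X) (S : Set (Node Q X)) : Prop :=
  (∀ n ∈ S, ∃ m, σ.mark n = .tentative m) ∧
    ∀ n m, σ.mark n = .tentative m → n ∉ S → A.Subsumed σ n m

/-- The invariants that depend on the position in the program. -/
def Ctrl.Inv (A : TimedAutomaton Q X) (σ : Store Q X) : Ctrl Q X → Prop
  | main => ResolveInv A σ ∅
  | explore n Ls => (A.nodeZone n).Nonempty ∧ ∀ L ∈ Ls, L.Finite
  | loop Ls => ∀ L ∈ Ls, L.Finite
  | resolving S => ResolveInv A σ S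
  | pushing n S => (A.nodeZone n).Nonempty ∧ ResolveInv A σ S

/-- Every node of the tree that is not explored waits for being explored, once. -/
structure PendInv (A : TimedAutomaton Q X) (σ : Store Q X) (C : Ctrl Q X) : Prop where
  le_one : ∀ n, pendCount σ.stack C n ≤ 1
  spec : ∀ n, pendCount σ.stack C n ≠ 0 → σ.mark n = .unexplored ∧ A.InTree σ.mark n
  pending : ∀ n, A.InTree σ.mark n → (A.nodeZone n).Nonempty → σ.mark n = .unexplored →
    pendCount σ.stack C n ≠ 0
  stack_nonempty : ∀ n ∈ σ.stack, (A.nodeZone n).Nonempty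

/-- The invariants of the algorithm. -/
structure Inv (A : TimedAutomaton Q X) (N : ℕ) (σ : Store Q X) (P : List (PropFrame Q X))
    (C : Ctrl Q X) : Prop where
  marks : A.MarkInv N σ
  prop : PropInv A C.up σ P
  pend : PendInv A σ C
  ctrl : C.Inv A σ
  quiet : ¬ C.Propagates → P = []

/-- The configuration with the given store and call stack. -/
def mkConfig (σ : Store Q X) (P : List (PropFrame Q X)) (C : Ctrl Q X) : Config Q X :=
  .run σ (P.map PropFrame.toFrame ++ C.frames)

/-- The termination measure of a round of the main loop. -/
noncomputable def roundMeasure (N : ℕ) (σ : Store Q X) (P : List (PropFrame Q X))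
    (C : Ctrl Q X) : ℕ ×ₗ ℕ ×ₗ ℕ ×ₗ ℕ :=
  toLex (C.phase, toLex
    (Nat.card (Q × Set (RegionSignature X N)) - {n | σ.mark n = .nontentative}.ncard,
      toLex (potential N C.up σ, (P.map PropFrame.weight).sum + C.weight)))

section Measure

variable {N : ℕ} {σ σ' : Store Q X} {P P' : List (PropFrame Q X)} {C C' : Ctrl Q X}

theorem roundMeasure_lt_of_phase (h : C'.phase < C.phase) :
    roundMeasure N σ' P' C' < roundMeasure N σ P C :=
  Prod.Lex.toLex_lt_toLex.2 (.inl h)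

theorem roundMeasure_lt_of_ncard (h : C'.phase = C.phase)
    (h1 : {n | σ.mark n = .nontentative}.ncard < {n | σ'.mark n = .nontentative}.ncard)
    (h2 : {n | σ'.mark n = .nontentative}.ncard ≤ Nat.card (Q × Set (RegionSignature X N))) :
    roundMeasure N σ' P' C' < roundMeasure N σ P C :=
  Prod.Lex.toLex_lt_toLex.2 (.inr ⟨h, Prod.Lex.toLex_lt_toLex.2 (.inl (by
    change _ - _ < _ - _
    omega))⟩)

theorem roundMeasure_lt_of_potential (h : C'.phase = C.phase)
    (h1 : ∀ n, σ'.mark n = .nontentative ↔ σ.mark n = .nontentative)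
    (h2 : potential N C'.up σ' < potential N C.up σ ∨
      potential N C'.up σ' ≤ potential N C.up σ ∧
        (P'.map PropFrame.weight).sum + C'.weight < (P.map PropFrame.weight).sum + C.weight) :
    roundMeasure N σ' P' C' < roundMeasure N σ P C := by
  refine Prod.Lex.toLex_lt_toLex.2 (.inr ⟨h, Prod.Lex.toLex_lt_toLex.2 (.inr ⟨?_, ?_⟩)⟩)
  · simp only [h1]
  · refine Prod.Lex.toLex_lt_toLex.2 ?_
    rcases h2 with h2 | ⟨h2, h3⟩
    · exact .inl h2
    · rcases h2.lt_or_eq with h4 | h4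
      · exact .inl h4
      · exact .inr ⟨h4, h3⟩

theorem roundMeasure_lt_of_weight (h : C'.phase = C.phase) (hup : C'.up = C.up)
    (h1 : ∀ n, σ'.mark n = .nontentative ↔ σ.mark n = .nontentative)
    (h2 : ∀ n, σ.mark n = .nontentative → σ'.bound n = σ.bound n)
    (h3 : (P'.map PropFrame.weight).sum + C'.weight < (P.map PropFrame.weight).sum + C.weight) :
    roundMeasure N σ' P' C' < roundMeasure N σ P C :=
  roundMeasure_lt_of_potential h h1 (.inr ⟨by rw [hup, potential_congr h1 h2], h3⟩)

end Measure

/-! ### Changes of marks -/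

namespace TimedAutomaton

variable {A : TimedAutomaton Q X} {N : ℕ} {σ : Store Q X}

theorem not_mem_children_self (n : Node Q X) : n ∉ A.children n := by
  rintro ⟨t, -, -, h⟩
  exact absurd (congrArg List.length h) (by simp)

theorem inTree_congr {μ ν : Node Q X → Mark Q X}
    (h : ∀ n, ν n = .nontentative ↔ μ n = .nontentative) (n : Node Q X) :
    A.InTree ν n ↔ A.InTree μ n := by
  simp only [InTree, h]

theorem setMark_nontentative_iff {n : Node Q X} {a : Mark Q X} (hn : σ.mark n ≠ .nontentative)
    (ha : a ≠ .nontentative) (k : Node Q X) :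
    (σ.setMark n a).mark k = .nontentative ↔ σ.mark k = .nontentative := by
  rw [Store.setMark_mark]
  split_ifs with e
  · subst e
    exact iff_of_false ha hn
  · rfl

theorem subsumed_self_of_key (hb : ∀ n x, σ.bound n x ≤ (N : WithBot ℕ)) {n m : Node Q X}
    (h : A.nodeKey N n = A.nodeKey N m) : A.Subsumed σ n m :=
  subset_closureAbs_of_image_subset (hb m) (congrArg Prod.snd h).le

theorem MarkInv.setTentative (h : A.MarkInv N σ) {n m : Node Q X}
    (hn : σ.mark n = .unexplored) (ht : A.InTree σ.mark n) (hz : (A.nodeZone n).Nonempty)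
    (hm : A.Covers σ m n) :
    A.MarkInv N ((σ.setMark n (.tentative m)).setBound n (σ.bound m)) := by
  have hmk := setMark_nontentative_iff (σ := σ) (n := n) (a := .tentative m)
    (by rw [hn]; simp) (by simp)
  refine ⟨?_, ?_, ?_, ?_, ?_, ?_, ?_⟩
  · intro k hk
    rw [Store.setBound_mark, inTree_congr hmk]
    rw [Store.setBound_mark, Store.setMark_mark] at hk
    split_ifs at hk with e
    · exact e ▸ ht
    · exact h.inTree k hk
  · intro k hk
    rw [Store.setBound_mark, Store.setMark_mark] at hk
    split_ifs at hk with e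
    · exact e ▸ hz
    · exact h.nonempty k hk
  · intro k l hk
    rw [Store.setBound_mark, hmk]
    rw [Store.setBound_mark, Store.setMark_mark] at hk
    split_ifs at hk with e
    · cases hk
      exact e ▸ ⟨hm.1, hm.2.1⟩
    · exact h.cover k l hk
  · intro k hk
    exact h.notAccepting k ((hmk k).1 hk)
  · intro k l hk hl
    exact h.key_injOn k l ((hmk k).1 hk) ((hmk l).1 hl)
  · intro k hk
    rw [Store.setBound_mark, Store.setMark_mark] at hk
    split_ifs at hk with e
    rw [Store.setBound_bound_of_ne _ e]
    exact h.bound_eq_bot k hk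
  · intro k x
    rw [Store.setBound_bound]
    split_ifs
    · exact h.bound_le m x
    · exact h.bound_le k x

theorem MarkInv.setNontentative (h : A.MarkInv N σ) {n : Node Q X}
    (ht : A.InTree σ.mark n) (hz : (A.nodeZone n).Nonempty)
    (ha : A.nodeState n ∉ A.accepting) (hm : ∀ m, ¬ A.Covers σ m n) :
    A.MarkInv N (σ.setMark n .nontentative) := by
  have hmk {k : Node Q X} (hk : σ.mark k = .nontentative) :
      (σ.setMark n .nontentative).mark k = .nontentative := by
    rw [Store.setMark_mark]
    split_ifs
    · rfl
    · exact hk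
  have htree {k : Node Q X} (hk : A.InTree σ.mark k) :
      A.InTree (σ.setMark n .nontentative).mark k := by
    rcases hk with hk | ⟨l, hl, hk⟩
    · exact .inl hk
    · exact .inr ⟨l, hmk hl, hk⟩
  have hkey {k : Node Q X} (hk : σ.mark k = .nontentative) : A.nodeKey N n ≠ A.nodeKey N k :=
    fun e => hm k ⟨hk, (congrArg Prod.fst e).symm, subsumed_self_of_key h.bound_le e⟩
  refine ⟨?_, ?_, ?_, ?_, ?_, ?_, ?_⟩
  · intro k hk
    rw [Store.setMark_mark] at hk
    split_ifs at hk with e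
    · exact htree (e ▸ ht)
    · exact htree (h.inTree k hk)
  · intro k hk
    rw [Store.setMark_mark] at hk
    split_ifs at hk with e
    · exact e ▸ hz
    · exact h.nonempty k hk
  · intro k l hk
    rw [Store.setMark_mark] at hk
    split_ifs at hk with e
    have := h.cover k l hk
    exact ⟨hmk this.1, this.2⟩
  · intro k hk
    rw [Store.setMark_mark] at hk
    split_ifs at hk with e
    · exact e ▸ ha
    · exact h.notAccepting k hk
  · intro k l hk hl e
    rw [Store.setMark_mark] at hk hl
    split_ifs at hk hl with e1 e2 e2
    · rw [e1, e2]
    · exact absurd (e1 ▸ e) (hkey hl)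
    · exact absurd (e2 ▸ e.symm) (hkey hk)
    · exact h.key_injOn k l hk hl e
  · intro k hk
    rw [Store.setMark_mark] at hk
    split_ifs at hk with e
    exact h.bound_eq_bot k hk
  · exact h.bound_le

theorem MarkInv.setUnexplored (h : A.MarkInv N σ) {n m : Node Q X}
    (hn : σ.mark n = .tentative m) :
    A.MarkInv N ((σ.setMark n .unexplored).setBound n ⊥) := by
  have hmk := setMark_nontentative_iff (σ := σ) (n := n) (a := .unexplored)
    (by rw [hn]; simp) (by simp)
  refine ⟨?_, ?_, ?_, ?_, ?_, ?_, ?_⟩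
  · intro k hk
    rw [Store.setBound_mark, inTree_congr hmk]
    rw [Store.setBound_mark, Store.setMark_mark] at hk
    split_ifs at hk with e
    · exact absurd rfl hk
    · exact h.inTree k hk
  · intro k hk
    rw [Store.setBound_mark, Store.setMark_mark] at hk
    split_ifs at hk with e
    · exact absurd rfl hk
    · exact h.nonempty k hk
  · intro k l hk
    rw [Store.setBound_mark, hmk]
    rw [Store.setBound_mark, Store.setMark_mark] at hk
    split_ifs at hk with e
    exact h.cover k l hk
  · intro k hk
    exact h.notAccepting k ((hmk k).1 hk)
  · intro k l hk hl
    exact h.key_injOn k l ((hmk k).1 hk) ((hmk l).1 hl)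
  · intro k hk
    rw [Store.setBound_bound]
    rw [Store.setBound_mark, Store.setMark_mark] at hk
    split_ifs at hk ⊢ with e
    · rfl
    · exact h.bound_eq_bot k hk
  · intro k x
    rw [Store.setBound_bound]
    split_ifs
    · exact bot_le
    · exact h.bound_le k x

end TimedAutomaton

namespace PropInv

open TimedAutomaton

variable {A : TimedAutomaton Q X} {N : ℕ} {up : Bool} {σ : Store Q X}

/-- Setting the mark and the bound function of a node that is not nontentative. -/
theorem setMark_setBound (hM : A.MarkInv N σ) (hP : PropInv A up σ []) {n : Node Q X}
    (hn : σ.mark n ≠ .nontentative) {a : Mark Q X} {β : Bound X} (hβ : DirLE up (σ.bound n) β)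
    (ha : a = .unexplored ∨ ∃ m, a = .tentative m ∧ m ≠ n ∧ β = σ.bound m)
    (hp : σ.mark n.tail = .nontentative) :
    PropInv A up ((σ.setMark n a).setBound n β) [.call n.tail] := by
  have hmk := setMark_nontentative_iff (σ := σ) (n := n) (a := a) hn (by
    rcases ha with rfl | ⟨m, rfl, -⟩ <;> simp)
  have hne {k : Node Q X} (hk : σ.mark k = .nontentative) : k ≠ n := by
    rintro rfl
    exact hn hk
  have htent {k l : Node Q X} (hk : (σ.setMark n a).mark k = .tentative l) :
      ((σ.setMark n a).setBound n β).bound k = ((σ.setMark n a).setBound n β).bound l := by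
    rw [Store.setMark_mark] at hk
    split_ifs at hk with e
    · rcases ha with rfl | ⟨m, rfl, hm, rfl⟩
      · cases hk
      · cases hk
        subst e
        rw [Store.setBound_bound_self, Store.setBound_bound_of_ne _ hm]
        rfl
    · rw [Store.setBound_bound_of_ne _ e,
        Store.setBound_bound_of_ne _ (hne (hM.cover k l hk).1)]
      exact hP.eq_cover hk
  have hdir (k : Node Q X) := A.DirLE_childrenBound_setBound (σ.setMark n a) (n := k) hβ
  refine ⟨?_, by simp, ?_, ?_, ?_, ?_⟩
  · intro k hk
    simp only [List.mem_singleton, PropFrame.call.injEq] at hk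
    subst hk
    exact (hmk _).2 hp
  · intro k hk
    rw [Store.setBound_bound_of_ne _ (hne ((hmk k).1 hk))]
    exact (hP.nontentative_dir k ((hmk k).1 hk)).trans (hdir k)
  · intro k l hk
    exact .of_eq (htent hk)
  · intro k hk
    by_cases hc : n ∈ A.children k
    · right; left
      rw [tail_eq_of_mem_children hc]
      simp
    · left
      rw [Store.setBound_bound_of_ne _ (hne ((hmk k).1 hk)),
        A.childrenBound_setBound_of_notMem _ _ hc]
      exact hP.eq_childrenBound ((hmk k).1 hk)
  · intro k l hk
    exact .inl (htent hk)

theorem setNontentative (hM : A.MarkInv N σ) (hP : PropInv A true σ []) {n : Node Q X}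
    (hn : σ.mark n = .unexplored) :
    PropInv A true (σ.setMark n .nontentative) [.call n] := by
  have htent {k l : Node Q X} (hk : (σ.setMark n .nontentative).mark k = .tentative l) :
      σ.bound k = σ.bound l := by
    rw [Store.setMark_mark] at hk
    split_ifs at hk with e
    exact hP.eq_cover hk
  refine ⟨?_, by simp, ?_, fun k l hk => .of_eq (htent hk), ?_, fun k l hk => .inl (htent hk)⟩
  · intro k hk
    simp only [List.mem_singleton, PropFrame.call.injEq] at hk
    subst hk
    exact Store.setMark_mark_self _ _ _
  · intro k hk
    rw [Store.setMark_mark] at hk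
    split_ifs at hk with e
    · subst e
      change _ ≤ _
      rw [Store.setMark_bound, hM.bound_eq_bot _ hn]
      exact bot_le
    · exact hP.nontentative_dir k hk
  · intro k hk
    rw [Store.setMark_mark] at hk
    split_ifs at hk with e
    · subst e
      simp
    · exact .inl (hP.eq_childrenBound hk)

end PropInv

namespace PendInv

open TimedAutomaton

variable {A : TimedAutomaton Q X} {N : ℕ} {σ τ : Store Q X} {C C' : Ctrl Q X}

/-- The pending nodes stay the same, apart from nodes with an empty zone. -/
theorem congr (h : PendInv A σ C) (hm : τ.mark = σ.mark)
    (h1 : ∀ n, pendCount τ.stack C' n ≤ pendCount σ.stack C n)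
    (h2 : ∀ n, (A.nodeZone n).Nonempty → pendCount τ.stack C' n = pendCount σ.stack C n)
    (h3 : ∀ n ∈ τ.stack, (A.nodeZone n).Nonempty) : PendInv A τ C' where
  le_one n := (h1 n).trans (h.le_one n)
  spec n hn := by
    rw [hm]
    exact h.spec n fun e => hn (Nat.le_zero.1 (e ▸ h1 n))
  pending n := by
    rw [hm]
    intro ht hz hu
    rw [h2 n hz]
    exact h.pending n ht hz hu
  stack_nonempty := h3

open Classical in
/-- The node `n` is marked tentative and does not wait any more. -/
theorem setTentative (h : PendInv A σ C) {n m : Node Q X} (hs : τ.stack = σ.stack)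
    (hτ : τ.mark = (σ.setMark n (.tentative m)).mark) (hn : σ.mark n = .unexplored)
    (hc : ∀ k, pendCount σ.stack C k = (if k = n then 1 else 0) + pendCount σ.stack C' k) :
    PendInv A τ C' := by
  have hmk := setMark_nontentative_iff (σ := σ) (n := n) (a := .tentative m)
    (by rw [hn]; simp) (by simp)
  refine ⟨fun k => ?_, fun k hk => ?_, fun k => ?_, by rw [hs]; exact h.stack_nonempty⟩
  · have := h.le_one k
    rw [hc] at this
    rw [hs]
    omega
  · rw [hs] at hk
    have h1 := h.le_one k
    have h2 := h.spec k
    rw [hc] at h1 h2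
    rw [hτ, inTree_congr hmk, Store.setMark_mark]
    split_ifs at h1 h2 ⊢ with e
    · omega
    · exact h2 (by omega)
  · rw [hτ, hs, inTree_congr hmk, Store.setMark_mark]
    split_ifs with e
    · simp
    · intro ht hz hu
      have := h.pending k ht hz hu
      rw [hc, if_neg e] at this
      omega

open Classical in
/-- The node `n` is marked nontentative, and its children wait instead. -/
theorem setNontentative (hM : A.MarkInv N σ) (h : PendInv A σ C) {n : Node Q X}
    (hn : σ.mark n = .unexplored) {c : Node Q X → ℕ}
    (hc : ∀ k, pendCount σ.stack C k = (if k = n then 1 else 0) + c k)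
    (hc' : ∀ k, pendCount σ.stack C' k = (if k ∈ A.children n then 1 else 0) + c k) :
    PendInv A (σ.setMark n .nontentative) C' := by
  have hch {k : Node Q X} (hk : k ∈ A.children n) : σ.mark k = .unexplored ∧ c k = 0 := by
    have h0 := ne_nil_of_mem_children hk
    have ht := tail_eq_of_mem_children hk
    constructor
    · by_contra hu
      have := hM.parent hu h0
      rw [ht, hn] at this
      cases this
    · by_contra hne
      rcases (h.spec k (by rw [hc]; omega)).2 with h1 | ⟨l, hl, h1⟩
      · exact h0 h1
      · have := tail_eq_of_mem_children h1
        rw [← this, ht, hn] at hl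
        cases hl
  have htree (k : Node Q X) : A.InTree (σ.setMark n .nontentative).mark k ↔
      A.InTree σ.mark k ∨ k ∈ A.children n := by
    constructor
    · rintro (h1 | ⟨l, hl, h1⟩)
      · exact .inl (.inl h1)
      · rw [Store.setMark_mark] at hl
        split_ifs at hl with e
        · exact .inr (e ▸ h1)
        · exact .inl (.inr ⟨l, hl, h1⟩)
    · rintro ((h1 | ⟨l, hl, h1⟩) | h1)
      · exact .inl h1
      · refine .inr ⟨l, ?_, h1⟩
        rw [Store.setMark_mark]
        split_ifs
        · rfl
        · exact hl
      · exact .inr ⟨n, Store.setMark_mark_self _ _ _, h1⟩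
  refine ⟨fun k => ?_, fun k hk => ?_, fun k => ?_, h.stack_nonempty⟩
  · rw [Store.setMark_stack, hc']
    have := h.le_one k
    rw [hc] at this
    by_cases e : k ∈ A.children n
    · rw [if_pos e, (hch e).2]
    · rw [if_neg e]
      omega
  · rw [Store.setMark_stack, hc'] at hk
    rw [htree, Store.setMark_mark]
    by_cases e : k ∈ A.children n
    · rw [if_neg (by rintro rfl; exact not_mem_children_self _ e)]
      exact ⟨(hch e).1, .inr e⟩
    · rw [if_neg e] at hk
      have h1 := h.le_one k
      have h2 := h.spec k
      rw [hc] at h1 h2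
      have hkn : k ≠ n := by
        rintro rfl
        rw [if_pos rfl] at h1
        omega
      rw [if_neg hkn]
      have := h2 (by omega)
      exact ⟨this.1, .inl this.2⟩
  · rw [Store.setMark_stack, hc', htree, Store.setMark_mark]
    split_ifs with e1 e2 e2
    · simp
    · simp
    · omega
    · rintro (ht | ht) hz hu
      · have := h.pending k ht hz hu
        rw [hc, if_neg e1] at this
        omega
      · exact absurd ht e2

open Classical in
/-- The tentative node `n` is marked unexplored and waits. -/
theorem setUnexplored (hM : A.MarkInv N σ) (h : PendInv A σ C) {n m : Node Q X}
    (hs : τ.stack = σ.stack) (hτ : τ.mark = (σ.setMark n .unexplored).mark)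
    (hn : σ.mark n = .tentative m)
    (hc : ∀ k, pendCount σ.stack C' k = (if k = n then 1 else 0) + pendCount σ.stack C k) :
    PendInv A τ C' := by
  have hmk := setMark_nontentative_iff (σ := σ) (n := n) (a := .unexplored)
    (by rw [hn]; simp) (by simp)
  have h0 : pendCount σ.stack C n = 0 := by
    by_contra hne
    have := (h.spec n hne).1
    rw [hn] at this
    cases this
  refine ⟨fun k => ?_, fun k hk => ?_, fun k => ?_, by rw [hs]; exact h.stack_nonempty⟩
  · have := h.le_one k
    rw [hs, hc]
    split_ifs with e
    · rw [e, h0]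
    · omega
  · rw [hs, hc] at hk
    rw [hτ, inTree_congr hmk, Store.setMark_mark]
    split_ifs at hk ⊢ with e
    · exact ⟨rfl, e ▸ hM.inTree n (by rw [hn]; simp)⟩
    · exact h.spec k (by omega)
  · rw [hτ, hs, hc, inTree_congr hmk, Store.setMark_mark]
    split_ifs with e
    · omega
    · intro ht hz hu
      have := h.pending k ht hz hu
      omega

end PendInv

theorem ResolveInv.of_le {A : TimedAutomaton Q X} {σ τ : Store Q X} {S : Set (Node Q X)}
    (h : ResolveInv A σ S) (hm : τ.mark = σ.mark) (hb : ∀ n, τ.bound n ≤ σ.bound n) :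
    ResolveInv A τ S := by
  refine ⟨by rw [hm]; exact h.1, fun n m hn hS => ?_⟩
  rw [hm] at hn
  exact (h.2 n m hn hS).trans (closureAbs_anti (hb m) _)

end Control

/-! ### Correctness of the answer "empty" -/

section Main

variable {Q X : Type*} {A : TimedAutomaton Q X} {N : ℕ} {σ : Store Q X}
  {P : List (PropFrame Q X)} {C : Ctrl Q X}

open TimedAutomaton

theorem exists_sameRegion_of_reachable [Finite X] {up : Bool} (hM : A.MarkInv N σ)
    (hP : PropInv A up σ []) (hR : ResolveInv A σ ∅)
    (hall : ∀ n, A.InTree σ.mark n → (A.nodeZone n).Nonempty → σ.mark n ≠ .unexplored)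
    {a : Q × Set (Valuation X)}
    (ha : Relation.ReflTransGen A.ZoneEdge (A.start, initialZone X) a) :
    ∀ v ∈ a.2, ∃ n, σ.mark n = .nontentative ∧ A.nodeState n = a.1 ∧
      ∃ w ∈ A.nodeZone n, SameRegion (σ.bound n) v w := by
  have key {n : Node Q X} {v w : Valuation X} (hn : A.InTree σ.mark n) (hw : w ∈ A.nodeZone n)
      (hvw : SameRegion (σ.bound n) v w) : ∃ m, σ.mark m = .nontentative ∧
        A.nodeState m = A.nodeState n ∧ ∃ u ∈ A.nodeZone m, SameRegion (σ.bound m) v u := by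
    cases hmark : σ.mark n with
    | unexplored => exact absurd hmark (hall n hn ⟨w, hw⟩)
    | nontentative => exact ⟨n, hmark, rfl, w, hw, hvw⟩
    | tentative m =>
      obtain ⟨h1, h2⟩ := hM.cover n m hmark
      obtain ⟨u, hu, hwu⟩ := mem_closureAbs.1 (hR.2 n m hmark (Set.notMem_empty n) hw)
      refine ⟨m, h1, h2, u, hu, SameRegion.trans ?_ hwu⟩
      rwa [hP.eq_cover hmark] at hvw
  induction ha with
  | refl =>
    intro v hv
    exact key (n := []) (.inl rfl) hv (SameRegion.refl _ v)
  | tail _ hab ih =>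
    rintro v' hv'
    obtain ⟨t, ht, hsrc, hdst, hpost⟩ := hab
    rw [hpost] at hv'
    obtain ⟨v, hv, d, hfire⟩ := hv'
    obtain ⟨n, hn, hstate, w, hw, hvw⟩ := ih v hv
    have hs : t.src = A.nodeState n := hsrc.trans hstate.symm
    have hα : maxedge t.guard t.reset (σ.bound (t :: n)) ≤ σ.bound n := by
      rw [hP.eq_childrenBound hn]
      exact A.maxedge_le_childrenBound σ ht hs
    obtain ⟨d', w', hfire', hvw'⟩ := hvw.exists_fires hα hfire
    obtain ⟨m, h1, h2, h3⟩ := key (n := t :: n) (.inr ⟨n, hn, t, ht, hs, rfl⟩)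
      ⟨w, hw, d', hfire'⟩ hvw'
    exact ⟨m, h1, h2.trans hdst, h3⟩

theorem Inv.not_acceptingReachable [Finite X] (hI : Inv A N σ [] .main) (hs : σ.stack = []) :
    ¬ A.AcceptingReachable := by
  rintro ⟨q, Z, hreach, hq, v, hv⟩
  have hall (n : Node Q X) (ht : A.InTree σ.mark n) (hz : (A.nodeZone n).Nonempty) :
      σ.mark n ≠ .unexplored := fun hu => hI.pend.pending n ht hz hu (by
    simp [pendCount, hs, Ctrl.count])
  obtain ⟨n, hn, hstate, -⟩ :=
    exists_sameRegion_of_reachable hI.marks hI.prop hI.ctrl hall hreach v hv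
  exact hI.marks.notAccepting n hn (hstate ▸ hq)

/-! ### The steps of the algorithm -/

theorem Ctrl.loopCount_diff_singleton {L : Set (Node Q X)} {Ls : List (Set (Node Q X))}
    {m : Node Q X} (hm : m ∈ L) (k : Node Q X) [Decidable (k = m)] :
    Ctrl.loopCount (L :: Ls) k =
      (if k = m then 1 else 0) + Ctrl.loopCount ((L \ {m}) :: Ls) k := by
  classical
  simp only [Ctrl.loopCount, List.map_cons, List.sum_cons]
  by_cases e : k = m
  · subst e
    simp [hm]
  · have : k ∈ L \ {m} ↔ k ∈ L := ⟨fun h => h.1, fun h => ⟨h, e⟩⟩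
    rw [if_neg e, zero_add]
    by_cases hk : k ∈ L
    · rw [if_pos hk, if_pos (this.2 hk)]
    · rw [if_neg hk, if_neg (mt this.1 hk)]

theorem count_cons_eq_add {α : Type*} [BEq α] [LawfulBEq α] (a b : α) (s : List α)
    [Decidable (b = a)] :
    (a :: s).count b = (if b = a then 1 else 0) + s.count b := by
  rw [List.count_cons, add_comm]
  by_cases h : b = a
  · simp [h]
  · simp [h, Ne.symm h]

/-- The possible outcomes of a step. -/
def StepResult (A : TimedAutomaton Q X) (N : ℕ) (σ : Store Q X) (P : List (PropFrame Q X))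
    (C : Ctrl Q X) (c : Config Q X) : Prop :=
  (∃ σ' P' C', c = mkConfig σ' P' C' ∧ Inv A N σ' P' C' ∧
    ((∃ k, mkConfig σ P C = .run σ (.resolve :: k)) ∨
      roundMeasure N σ' P' C' < roundMeasure N σ P C)) ∨
  (c = .notEmpty ∧ A.AcceptingReachable) ∨ (c = .empty ∧ ¬ A.AcceptingReachable)

theorem Inv.step_main [Finite X] (hI : Inv A N σ [] .main) {c : Config Q X}
    (h : A.Step (mkConfig σ [] .main) c) : StepResult A N σ [] .main c := by
  classical
  cases h with
  | mainEnd _ _ h => exact .inr (.inr ⟨rfl, hI.not_acceptingReachable h⟩)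
  | mainPop _ n s _ h =>
    refine .inl ⟨σ.setStack s, [], .explore n [], rfl, ?_, .inr (roundMeasure_lt_of_phase ?_)⟩
    · refine ⟨?_, ?_, ?_, ?_, fun _ => rfl⟩
      · exact ⟨hI.marks.1, hI.marks.2, hI.marks.3, hI.marks.4, hI.marks.5, hI.marks.6,
          hI.marks.7⟩
      · exact .of_eq (fun _ => hI.prop.eq_childrenBound) (fun _ _ => hI.prop.eq_cover)
      · have hc (k : Node Q X) : pendCount s (.explore n []) k = pendCount σ.stack .main k := by
          simp only [pendCount, h, Ctrl.count, Ctrl.loopCount, List.map_nil, List.sum_nil,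
            count_cons_eq_add]
          omega
        refine hI.pend.congr rfl (fun k => (hc k).le) (fun k _ => hc k) fun k hk => ?_
        exact hI.pend.stack_nonempty k (h ▸ List.mem_cons_of_mem _ hk)
      · exact ⟨hI.pend.stack_nonempty n (h ▸ List.mem_cons_self), by simp⟩
    · simp [Ctrl.phase]

theorem Inv.step_explore [Finite Q] [Finite X] {n : Node Q X} {Ls : List (Set (Node Q X))}
    (hI : Inv A N σ [] (.explore n Ls)) {c : Config Q X}
    (h : A.Step (mkConfig σ [] (.explore n Ls)) c) : StepResult A N σ [] (.explore n Ls) c := by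
  classical
  obtain ⟨hz, hfin⟩ := hI.ctrl
  obtain ⟨hn, ht⟩ := hI.pend.spec n (by simp [pendCount, Ctrl.count])
  cases h with
  | exploreAccept _ _ _ h => exact .inr (.inl ⟨rfl, hI.marks.acceptingReachable ht h hz⟩)
  | exploreTentative _ _ m _ h hm =>
    have h0 : n ≠ [] := by
      rintro rfl
      have := hI.marks.root hm.1
      rw [hn] at this
      cases this
    have hp : σ.mark n.tail = .nontentative := by
      rcases ht with h1 | ⟨l, hl, h1⟩
      · exact absurd h1 h0
      · rwa [tail_eq_of_mem_children h1]
    have hmn : m ≠ n := by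
      rintro rfl
      have := hm.1
      rw [hn] at this
      cases this
    refine .inl ⟨_, [.call n.tail], .loop Ls, rfl, ?_, .inr ?_⟩
    · refine ⟨hI.marks.setTentative hn ht hz hm, ?_, ?_, hfin, fun h => absurd trivial h⟩
      · refine hI.prop.setMark_setBound hI.marks (by rw [hn]; simp) ?_
          (.inr ⟨m, rfl, hmn, rfl⟩) hp
        rw [hI.marks.bound_eq_bot n hn]
        exact bot_le (α := Bound X)
      · refine hI.pend.setTentative rfl rfl hn fun k => ?_
        simp only [pendCount, Ctrl.count]
        omega
    · refine roundMeasure_lt_of_weight rfl rfl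
        (setMark_nontentative_iff (by rw [hn]; simp) (by simp)) (fun k hk => ?_) ?_
      · refine Store.setBound_bound_of_ne _ ?_ _
        rintro rfl
        rw [hn] at hk
        cases hk
      · simp [PropFrame.weight, Ctrl.weight]
  | exploreExpand _ _ _ h hm =>
    have hM := hI.marks.setNontentative ht hz h hm
    refine .inl ⟨_, [.call n], .loop (A.children n :: Ls), rfl, ?_, .inr ?_⟩
    · refine ⟨hM, hI.prop.setNontentative hI.marks hn, ?_, ?_, fun h => absurd trivial h⟩
      · refine hI.pend.setNontentative hI.marks hn
          (c := fun k => σ.stack.count k + Ctrl.loopCount Ls k) (fun k => ?_) (fun k => ?_)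
        · simp only [pendCount, Ctrl.count]
          omega
        · simp only [pendCount, Ctrl.count, Ctrl.loopCount, List.map_cons, List.sum_cons]
          omega
      · intro L hL
        rcases List.mem_cons.1 hL with rfl | hL
        · exact A.finite_children n
        · exact hfin L hL
    · refine roundMeasure_lt_of_ncard rfl (Set.ncard_lt_ncard ?_ hM.finite_nontentative)
        hM.ncard_nontentative_le
      refine ⟨fun k hk => ?_, fun hsub => ?_⟩
      · change (σ.setMark n .nontentative).mark k = _
        rw [Store.setMark_mark]
        split_ifs
        · rfl
        · exact hk
      · have : σ.mark n = .nontentative := hsub (Store.setMark_mark_self σ n .nontentative)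
        rw [hn] at this
        cases this

theorem Inv.step_loop [Finite Q] [Finite X] {Ls : List (Set (Node Q X))}
    (hI : Inv A N σ [] (.loop Ls)) {c : Config Q X}
    (h : A.Step (mkConfig σ [] (.loop Ls)) c) : StepResult A N σ [] (.loop Ls) c := by
  classical
  cases Ls with
  | nil =>
    cases h with
    | resolveStart =>
      refine .inl ⟨σ, [], .resolving {n | ∃ m, σ.mark n = .tentative m}, rfl, ?_, .inl ⟨_, rfl⟩⟩
      refine ⟨hI.marks, hI.prop.change_dir _, ?_, ?_, fun _ => rfl⟩
      · exact hI.pend.congr rfl (fun _ => le_rfl) (fun _ _ => rfl) hI.pend.stack_nonempty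
      · exact ⟨fun n hn => hn, fun n m hn hn' => absurd ⟨m, hn⟩ hn'⟩
  | cons L Ls =>
    have hL : L.Finite := hI.ctrl L List.mem_cons_self
    have hLs : ∀ L ∈ Ls, L.Finite := fun L hL => hI.ctrl L (List.mem_cons_of_mem _ hL)
    have hdiff (m : Node Q X) : ∀ L' ∈ (L \ {m}) :: Ls, L'.Finite := by
      intro L' hL'
      rcases List.mem_cons.1 hL' with rfl | hL'
      · exact hL.subset Set.sdiff_subset
      · exact hLs L' hL'
    cases h with
    | exploreLoopChild _ _ m _ hm hz =>
      have hcard := Set.ncard_sdiff_singleton_lt_of_mem hm hL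
      refine .inl ⟨σ, [], .explore m ((L \ {m}) :: Ls), rfl, ?_, .inr ?_⟩
      · have hc (k : Node Q X) : pendCount σ.stack (.explore m ((L \ {m}) :: Ls)) k =
            pendCount σ.stack (.loop (L :: Ls)) k := by
          simp only [pendCount, Ctrl.count, Ctrl.loopCount_diff_singleton hm k]
        exact ⟨hI.marks, hI.prop, hI.pend.congr rfl (fun k => (hc k).le) (fun k _ => hc k)
          hI.pend.stack_nonempty, ⟨hz, hdiff m⟩, fun _ => rfl⟩
      · refine roundMeasure_lt_of_weight rfl rfl (fun _ => Iff.rfl) (fun _ _ => rfl) ?_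
        simp only [Ctrl.weight, List.map_cons, List.sum_cons]
        omega
    | exploreLoopSkip _ _ m _ hm hz =>
      have hcard := Set.ncard_sdiff_singleton_lt_of_mem hm hL
      refine .inl ⟨σ, [], .loop ((L \ {m}) :: Ls), rfl, ?_, .inr ?_⟩
      · have hc (k : Node Q X) : pendCount σ.stack (.loop (L :: Ls)) k =
            (if k = m then 1 else 0) + pendCount σ.stack (.loop ((L \ {m}) :: Ls)) k := by
          simp only [pendCount, Ctrl.count, Ctrl.loopCount_diff_singleton hm k]
          omega
        refine ⟨hI.marks, hI.prop, hI.pend.congr rfl (fun k => ?_) (fun k hk => ?_)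
          hI.pend.stack_nonempty, hdiff m, fun _ => rfl⟩
        · rw [hc]
          omega
        · rw [hc, if_neg, zero_add]
          rintro rfl
          exact hk.ne_empty hz
      · refine roundMeasure_lt_of_weight rfl rfl (fun _ => Iff.rfl) (fun _ _ => rfl) ?_
        simp only [Ctrl.weight, List.map_cons, List.sum_cons]
        omega
    | exploreLoopEnd =>
      refine .inl ⟨σ, [], .loop Ls, rfl, ?_, .inr ?_⟩
      · have hc (k : Node Q X) : pendCount σ.stack (.loop Ls) k =
            pendCount σ.stack (.loop (∅ :: Ls)) k := by
          simp [pendCount, Ctrl.count, Ctrl.loopCount]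
        exact ⟨hI.marks, hI.prop, hI.pend.congr rfl (fun k => (hc k).le) (fun k _ => hc k)
          hI.pend.stack_nonempty, hLs, fun _ => rfl⟩
      · refine roundMeasure_lt_of_weight rfl rfl (fun _ => Iff.rfl) (fun _ _ => rfl) ?_
        simp only [Ctrl.weight, List.map_cons, List.sum_cons]
        omega

theorem Inv.step_resolving [Finite Q] [Finite X] {S : Set (Node Q X)}
    (hI : Inv A N σ [] (.resolving S)) {c : Config Q X}
    (h : A.Step (mkConfig σ [] (.resolving S)) c) : StepResult A N σ [] (.resolving S) c := by
  classical
  have hR : ResolveInv A σ S := hI.ctrl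
  have hfin : S.Finite := hI.marks.finite_of_tentative hR.1
  cases h with
  | resolveLoopKeep _ _ n m _ hn hm h =>
    have hcard := Set.ncard_sdiff_singleton_lt_of_mem hn hfin
    refine .inl ⟨σ, [], .resolving (S \ {n}), rfl, ?_, .inr ?_⟩
    · refine ⟨hI.marks, hI.prop, hI.pend.congr rfl (fun _ => le_rfl) (fun _ _ => rfl)
        hI.pend.stack_nonempty, ⟨fun k hk => hR.1 k hk.1, fun k l hk hk' => ?_⟩, fun _ => rfl⟩
      by_cases e : k = n
      · subst e
        rw [hm] at hk
        cases hk
        exact h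
      · exact hR.2 k l hk fun hS => hk' ⟨hS, e⟩
    · refine roundMeasure_lt_of_weight rfl rfl (fun _ => Iff.rfl) (fun _ _ => rfl) ?_
      simp only [Ctrl.weight]
      omega
  | resolveLoopReopen _ _ n m _ hn hm h =>
    have hcard := Set.ncard_sdiff_singleton_lt_of_mem hn hfin
    have hnn : σ.mark n ≠ .nontentative := by rw [hm]; simp
    have hp := hI.marks.parent (n := n) (by rw [hm]; simp) (hI.marks.tentative_ne_nil hm)
    refine .inl ⟨_, [.call n.tail], .pushing n (S \ {n}), rfl, ?_, .inr ?_⟩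
    · refine ⟨hI.marks.setUnexplored hm, ?_, ?_, ?_, fun h => absurd trivial h⟩
      · exact hI.prop.setMark_setBound hI.marks hnn (bot_le (α := Bound X)) (.inl rfl) hp
      · refine hI.pend.setUnexplored hI.marks rfl rfl hm fun k => ?_
        simp only [pendCount, Ctrl.count]
        omega
      · refine ⟨hI.marks.nonempty n (by rw [hm]; simp), fun k hk => ?_, fun k l hk hk' => ?_⟩
        · obtain ⟨l, hl⟩ := hR.1 k hk.1
          exact ⟨l, by rw [Store.setBound_mark, Store.setMark_mark_of_ne _ hk.2, hl]⟩
        · rw [Store.setBound_mark, Store.setMark_mark] at hk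
          split_ifs at hk with e
          refine (hR.2 k l hk fun hS => hk' ⟨hS, e⟩).trans (closureAbs_anti ?_ _)
          rw [Store.setBound_bound]
          split_ifs
          · exact bot_le
          · exact le_rfl
    · refine roundMeasure_lt_of_weight rfl rfl (setMark_nontentative_iff hnn (by simp))
        (fun k hk => ?_) ?_
      · refine Store.setBound_bound_of_ne _ ?_ _
        rintro rfl
        exact hnn hk
      · simp only [List.map_cons, List.map_nil, List.sum_cons, List.sum_nil, PropFrame.weight,
          Ctrl.weight]
        omega
  | resolveLoopEnd =>
    refine .inl ⟨σ, [], .main, rfl, ?_, .inr (roundMeasure_lt_of_phase ?_)⟩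
    · exact ⟨hI.marks, hI.prop, hI.pend.congr rfl (fun _ => le_rfl) (fun _ _ => rfl)
        hI.pend.stack_nonempty, hR, fun _ => rfl⟩
    · simp [Ctrl.phase]

theorem Inv.step_pushing {n : Node Q X} {S : Set (Node Q X)}
    (hI : Inv A N σ [] (.pushing n S)) {c : Config Q X}
    (h : A.Step (mkConfig σ [] (.pushing n S)) c) : StepResult A N σ [] (.pushing n S) c := by
  classical
  obtain ⟨hz, hR⟩ := hI.ctrl
  cases h with
  | pushNode =>
    refine .inl ⟨_, [], .resolving S, rfl, ?_, .inr ?_⟩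
    · refine ⟨?_, ?_, ?_, ?_, fun _ => rfl⟩
      · exact ⟨hI.marks.1, hI.marks.2, hI.marks.3, hI.marks.4, hI.marks.5, hI.marks.6,
          hI.marks.7⟩
      · exact .of_eq (fun _ => hI.prop.eq_childrenBound) (fun _ _ => hI.prop.eq_cover)
      · have hc (k : Node Q X) : pendCount (n :: σ.stack) (.resolving S) k =
            pendCount σ.stack (.pushing n S) k := by
          simp only [pendCount, Ctrl.count, count_cons_eq_add]
          omega
        refine hI.pend.congr rfl (fun k => (hc k).le) (fun k _ => hc k) fun k hk => ?_
        rcases List.mem_cons.1 hk with rfl | hk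
        · exact hz
        · exact hI.pend.stack_nonempty k hk
      · exact hR
    · refine roundMeasure_lt_of_weight rfl rfl (fun _ => Iff.rfl) (fun _ _ => rfl) ?_
      simp only [Ctrl.weight]
      omega

theorem Ctrl.Inv.of_propagation {τ : Store Q X} (hC : C.Propagates) (h : C.Inv A σ)
    (hm : τ.mark = σ.mark) (hb : ∀ n, DirLE C.up (σ.bound n) (τ.bound n)) : C.Inv A τ := by
  cases C with
  | main => exact hC.elim
  | explore n Ls => exact hC.elim
  | loop Ls => exact h
  | resolving S => exact ResolveInv.of_le h hm hb
  | pushing n S => exact ⟨h.1, h.2.of_le hm hb⟩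

theorem Inv.step [Finite Q] [Finite X] (hN : A.GuardsBoundedBy N) (hI : Inv A N σ P C)
    {c : Config Q X} (h : A.Step (mkConfig σ P C) c) : StepResult A N σ P C c := by
  cases P with
  | nil =>
    cases C with
    | main => exact hI.step_main h
    | explore n Ls => exact hI.step_explore h
    | loop Ls => exact hI.step_loop h
    | resolving S => exact hI.step_resolving h
    | pushing n S => exact hI.step_pushing h
  | cons p P =>
    have hC : C.Propagates := by
      by_contra hC
      cases hI.quiet hC
    obtain ⟨σ', P', hc, hmark, hstack, hM, hP, hdir, hmeas⟩ :=
      propagation_step hN (k := P.map PropFrame.toFrame ++ C.frames) hI.marks hI.prop h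
    refine .inl ⟨σ', P' ++ P, C, ?_, ?_, .inr ?_⟩
    · rw [hc, mkConfig, List.map_append, List.append_assoc]
    · refine ⟨hM, hP, ?_, hI.ctrl.of_propagation hC hmark hdir, fun h => absurd hC h⟩
      refine hI.pend.congr hmark (fun k => ?_) (fun k _ => ?_) ?_ <;> rw [hstack]
      exact hI.pend.stack_nonempty
    · refine roundMeasure_lt_of_potential rfl (by simp [hmark]) (hmeas.imp_right fun h => ?_)
      refine ⟨h.1, ?_⟩
      simp only [List.map_append, List.sum_append, List.map_cons, List.sum_cons]
      omega

theorem Inv.exists_step [Finite X] (hI : Inv A N σ P C) : ∃ c, A.Step (mkConfig σ P C) c := by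
  cases P with
  | nil =>
    cases C with
    | main =>
      cases hs : σ.stack with
      | nil => exact ⟨_, .mainEnd _ _ hs⟩
      | cons n s => exact ⟨_, .mainPop _ n s _ hs⟩
    | explore n Ls =>
      by_cases ha : A.nodeState n ∈ A.accepting
      · exact ⟨_, .exploreAccept _ _ _ ha⟩
      · by_cases hm : ∃ m, A.Covers σ m n
        · obtain ⟨m, hm⟩ := hm
          exact ⟨_, .exploreTentative _ _ m _ ha hm⟩
        · exact ⟨_, .exploreExpand _ _ _ ha (not_exists.1 hm)⟩
    | loop Ls =>
      cases Ls with
      | nil => exact ⟨_, .resolveStart _ _⟩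
      | cons L Ls =>
        rcases L.eq_empty_or_nonempty with rfl | ⟨m, hm⟩
        · exact ⟨_, .exploreLoopEnd _ _⟩
        · rcases (A.nodeZone m).eq_empty_or_nonempty with hz | hz
          · exact ⟨_, .exploreLoopSkip _ _ m _ hm hz⟩
          · exact ⟨_, .exploreLoopChild _ _ m _ hm hz⟩
    | resolving S =>
      rcases S.eq_empty_or_nonempty with rfl | ⟨n, hn⟩
      · exact ⟨_, .resolveLoopEnd _ _⟩
      · have hR : ResolveInv A σ S := hI.ctrl
        obtain ⟨m, hm⟩ := hR.1 n hn
        by_cases hs : A.Subsumed σ n m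
        · exact ⟨_, .resolveLoopKeep _ _ n m _ hn hm hs⟩
        · exact ⟨_, .resolveLoopReopen _ _ n m _ hn hm hs⟩
    | pushing n S => exact ⟨_, .pushNode _ _ _⟩
  | cons p P =>
    cases p with
    | call n =>
      by_cases h : A.childrenBound σ n = σ.bound n
      · exact ⟨_, .propagateSame _ _ _ h⟩
      · exact ⟨_, .propagateChange _ _ _ h⟩
    | loop n S =>
      rcases S.eq_empty_or_nonempty with rfl | ⟨m, hm⟩
      · by_cases h0 : n = []
        · subst h0
          exact ⟨_, .propagateLoopRoot _ _⟩
        · exact ⟨_, .propagateLoopUp _ _ _ h0⟩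
      · exact ⟨_, .propagateLoopNext _ _ _ m _ hm⟩

/-! ### Executions -/

theorem exists_inv_initialConfig (A : TimedAutomaton Q X) (N : ℕ) :
    ∃ σ P C, initialConfig Q X = mkConfig σ P C ∧ Inv A N σ P C := by
  classical
  refine ⟨_, [], .main, rfl, ?_, ?_, ?_, ?_, fun _ => rfl⟩
  · exact ⟨by simp, by simp, by simp, by simp, by simp, fun _ _ => rfl, fun _ _ => bot_le⟩
  · exact .of_eq (by simp) (by simp)
  · have hc (n : Node Q X) : pendCount [[]] (.main : Ctrl Q X) n = if n = [] then 1 else 0 := by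
      simp [pendCount, Ctrl.count, count_cons_eq_add]
    refine ⟨fun n => ?_, fun n hn => ⟨rfl, .inl ?_⟩, ?_, ?_⟩
    · rw [hc]
      split_ifs <;> omega
    · by_contra h0
      exact hn (by rw [hc, if_neg h0])
    · rintro n (rfl | ⟨m, hm, -⟩) - -
      · rw [hc]
        simp
      · cases hm
    · intro n hn
      rw [List.mem_singleton.1 hn]
      exact Set.singleton_nonempty _
  · exact ⟨by simp, by simp⟩

/-- The configurations that an execution can go through. -/
def GoodConfig (A : TimedAutomaton Q X) (N : ℕ) (c : Config Q X) : Prop :=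
  (∃ σ P C, c = mkConfig σ P C ∧ Inv A N σ P C) ∨
  (c = .notEmpty ∧ A.AcceptingReachable) ∨ (c = .empty ∧ ¬ A.AcceptingReachable)

variable {ρ : ℕ → Config Q X}

theorem IsExecution.goodConfig [Finite Q] [Finite X] (hN : A.GuardsBoundedBy N)
    (hρ : A.IsExecution ρ) (i : ℕ) : GoodConfig A N (ρ i) := by
  induction i with
  | zero =>
    rw [hρ.1]
    exact .inl (exists_inv_initialConfig A N)
  | succ i ih =>
    rcases hρ.2 i with h | ⟨-, h⟩
    · rcases ih with ⟨σ, P, C, hc, hI⟩ | ⟨hc, -⟩ | ⟨hc, -⟩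
      · rw [hc] at h
        rcases hI.step hN h with ⟨σ', P', C', hc', hI', -⟩ | h'
        · exact .inl ⟨σ', P', C', hc', hI'⟩
        · exact .inr h'
      · rw [hc] at h
        cases h
      · rw [hc] at h
        cases h
    · rwa [h]

theorem IsExecution.exists_halts [Finite Q] [Finite X] (hN : A.GuardsBoundedBy N)
    (hρ : A.IsExecution ρ) (hfin : FinitelyManyResolutions ρ) :
    ∃ i, ρ i = .notEmpty ∨ ρ i = .empty := by
  obtain ⟨b, hb⟩ := hfin.bddAbove
  by_contra! hne
  have hrun (i : ℕ) : ∃ σ P C, ρ i = mkConfig σ P C ∧ Inv A N σ P C := by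
    rcases IsExecution.goodConfig hN hρ i with h | ⟨h, -⟩ | ⟨h, -⟩
    · exact h
    · exact absurd h (hne i).1
    · exact absurd h (hne i).2
  obtain ⟨σ, P, C, hc, hI⟩ := hrun (b + 1)
  have key : ∀ μ : ℕ ×ₗ ℕ ×ₗ ℕ ×ₗ ℕ, ∀ i > b, ∀ σ P C, ρ i = mkConfig σ P C → Inv A N σ P C →
      roundMeasure N σ P C = μ → False := by
    intro μ
    induction μ using WellFoundedLT.induction with
    | ind μ ih =>
      rintro i hi σ P C hc hI rfl
      rcases hρ.2 i with h | ⟨h, -⟩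
      · rw [hc] at h
        rcases hI.step hN h with ⟨σ', P', C', hc', hI', ⟨k, hk⟩ | hlt⟩ | ⟨h', -⟩ | ⟨h', -⟩
        · have : i ≤ b := hb ⟨σ, k, hc.trans hk⟩
          omega
        · exact ih _ hlt (i + 1) (by omega) σ' P' C' hc' hI' rfl
        · exact (hne _).1 h'
        · exact (hne _).2 h'
      · obtain ⟨c, h'⟩ := hI.exists_step
        exact h c (hc ▸ h')
  exact key _ (b + 1) (by omega) _ _ _ hc hI rfl

theorem IsExecution.notEmpty_of_reaches (hρ : A.IsExecution ρ)
    (h : A.ReachesAcceptingNode ρ) : ∃ i, ρ i = .notEmpty := by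
  obtain ⟨i, σ, n, k, hi, ha, -⟩ := h
  refine ⟨i + 1, ?_⟩
  have hstep : ∃ c, A.Step (ρ i) c := ⟨_, by rw [hi]; exact .exploreAccept σ n k ha⟩
  rcases hρ.2 i with h | ⟨h, -⟩
  · rw [hi] at h
    generalize ρ (i + 1) = c at h
    cases h with
    | exploreAccept => rfl
    | exploreTentative _ _ _ _ h => exact absurd ha h
    | exploreExpand _ _ _ h => exact absurd ha h
  · exact absurd hstep (not_exists.2 h)

theorem IsExecution.reaches_of_notEmpty [Finite Q] [Finite X] (hN : A.GuardsBoundedBy N)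
    (hρ : A.IsExecution ρ) (h : ∃ i, ρ i = .notEmpty) : A.ReachesAcceptingNode ρ := by
  obtain ⟨i, hi⟩ := h
  induction i with
  | zero =>
    rw [hρ.1] at hi
    cases hi
  | succ i ih =>
    rcases hρ.2 i with h | ⟨-, h⟩
    · rw [hi] at h
      generalize hc : ρ i = c at h
      cases h with
      | exploreAccept σ n k ha =>
        refine ⟨i, σ, n, k, hc, ha, ?_⟩
        rcases IsExecution.goodConfig hN hρ i with ⟨σ', P, C, hc', hI⟩ | ⟨h, -⟩ | ⟨h, -⟩
        · rw [hc, mkConfig, Config.run.injEq] at hc'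
          obtain ⟨rfl, hk⟩ := hc'
          cases P with
          | cons p P => cases p <;> cases hk
          | nil =>
            cases C with
            | explore m Ls =>
              cases hk
              exact hI.ctrl.1
            | loop Ls => cases Ls <;> cases hk
            | main => cases hk
            | resolving S => cases hk
            | pushing m S => cases hk
        · rw [hc] at h
          cases h
        · rw [hc] at h
          cases h
    · exact ih (h ▸ hi)

end Main

end ReachTA

theorem mainTheorem4 {Q X : Type*} [Finite Q] [Finite X] (A : ReachTA.TimedAutomaton Q X)
    (ρ : ℕ → ReachTA.Config Q X) (hρ : A.IsExecution ρ) :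
    (A.ReachesAcceptingNode ρ → A.AcceptingReachable) ∧
    (ReachTA.FinitelyManyResolutions ρ →
      (A.AcceptingReachable ↔ A.ReachesAcceptingNode ρ) ∧
      (A.AcceptingReachable ↔ ∃ i, ρ i = .notEmpty) ∧
      (¬ A.AcceptingReachable ↔ ∃ i, ρ i = .empty)) := by
  obtain ⟨N, hN⟩ := A.exists_guardsBoundedBy
  have hgood := ReachTA.IsExecution.goodConfig hN hρ
  have hreach : A.ReachesAcceptingNode ρ ↔ ∃ i, ρ i = .notEmpty :=
    ⟨ReachTA.IsExecution.notEmpty_of_reaches hρ,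
      ReachTA.IsExecution.reaches_of_notEmpty hN hρ⟩
  have hyes : (∃ i, ρ i = .notEmpty) → A.AcceptingReachable := by
    rintro ⟨i, hi⟩
    rcases hgood i with ⟨σ, P, C, hc, -⟩ | ⟨-, h⟩ | ⟨hc, -⟩
    · rw [hi] at hc
      cases hc
    · exact h
    · rw [hi] at hc
      cases hc
  have hno : (∃ i, ρ i = .empty) → ¬ A.AcceptingReachable := by
    rintro ⟨i, hi⟩
    rcases hgood i with ⟨σ, P, C, hc, -⟩ | ⟨hc, -⟩ | ⟨-, h⟩
    · rw [hi] at hc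
      cases hc
    · rw [hi] at hc
      cases hc
    · exact h
  rw [hreach]
  refine ⟨hyes, fun hfin => ?_⟩
  obtain ⟨i, hi⟩ := ReachTA.IsExecution.exists_halts hN hρ hfin
  have h1 : A.AcceptingReachable ↔ ∃ i, ρ i = .notEmpty :=
    ⟨fun h => hi.elim (fun h' => ⟨i, h'⟩) fun h' => absurd h (hno ⟨i, h'⟩), hyes⟩
  exact ⟨h1, h1, fun h => hi.elim (fun h' => absurd (hyes ⟨i, h'⟩) h) fun h' => ⟨i, h'⟩, hno⟩
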